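/- Let $L_1,L_2\ge 1$, $m=L_1L_2$, and suppose that $n_F=(L_1-1)(L_2-1)$ is even. Let $F_m=\bigoplus_{n=0}^m\bigwedge^n\mathbb C^m$ be the fermionic Fock space with one mode for each vertex of the $L_1\times L_2$ square lattice (vertices $(x,y)$, $0\le x<L_1$, $0\le y<L_2$, $y$ pointing up), with annihilation operators $a_j$, and put $\gamma_j=a_j+a_j^\dagger$, $\bar\gamma_j=(a_j-a_j^\dagger)/i$, $E_{jk}=-i\gamma_j\gamma_k$, $V_j=-i\gamma_j\bar\gamma_j$. The compact encoding is defined as follows. Fix integers $a,b\ge 0$ (only their parities matter; they give the possible checkerboard labellings and orientations). The $n_F$ faces are named by their lower left vertices; the face $(x,y)$ is called odd if $x+a+y+b$ is even, and even otherwise (a checkerboard labelling). The horizontal edges in row $y$ are oriented to the left if $y+b$ is even and to the right otherwise; the vertical edges in column $x$ are oriented downwards if $x+a$ is even and upwards otherwise. (So the arrows circulate around every even face, clockwise and counterclockwise in alternate rows of faces.) There is one qubit for every vertex and one for every odd face. For an edge pointing from $j$ to $k$ let $\tilde E_{jk}$ be $X_jY_kY_f$ if the edge is horizontal, $X_jY_kX_f$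 if it points down, and $-X_jY_kX_f$ if it points up, where $f$ is the unique odd face adjacent to the edge and the factor on $f$ is omitted if there is no such face; put $\tilde E_{kj}=-\tilde E_{jk}$ and $\tilde V_j=Z_j$. To every face with boundary cycle $p_1p_2p_3p_4$ belongs the cycle operator $i^4\tilde E_{p_1p_2}\tilde E_{p_2p_3}\tilde E_{p_3p_4}\tilde E_{p_4p_1}$. Let $\mathcal L$ be the joint $+1$ eigenspace of the nontrivial cycle operators, i.e. those different from the identity. A corner vertex $c$ of the lattice is called odd if no even face touches it; for such $c$ let $\tilde\gamma_c=X_c$ if the arrows at $c$ point into $c$, and $\tilde\gamma_c=Y_c$ otherwise. Then the encoding uses $m+n_F/2$ qubits, so that $\mathcal L\subset(\mathbb C^2)^{\otimes(m+n_F/2)}$; the faces with nontrivial cycle operator are exactly the even ones, and there are $n_F/2$ of them; $\dim\mathcal L=2^m$; and an odd corner exists. Moreover, for every odd corner $c$ there is a $*$-isomorphism $\mu:L(F_m)\to L(\mathcal L)$ with $$\mu(E_{jk})=\tilde E_{jk}|_{\mathcal L}\ \text{ for every edge } jk,\qquad \mu(V_j)=\tilde V_j|_{\mathcal L}\ \text{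 for every vertex } j,\qquad \mu(\gamma_c)=\tilde\gamma_c|_{\mathcal L}$$ (in particular these encoded operators map $\mathcal L$ into itself), and there is an isometry $J:F_m\to\mathcal L$ such that $\mu(A)=JAJ^\dagger$ for all $A\in L(F_m)$. In particular the compact encoding is a fermionic mapping. -/

import Mathlib

noncomputable section

namespace CompactEncoding

/-! ### The fermionic Fock space of a finite set of modes -/

/-- Index set of the full tensor space `⨁_{n ≤ m} (ℂ^V)^{⊗ n}`, `m = |V|`: a word of length
`n ≤ m` in the modes stands for the elementary tensor of the corresponding unit vectors. -/
abbrev Word (V : Type*) [Fintype V] : Type _ :=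
  Σ n : Fin (Fintype.card V + 1), (Fin (n : ℕ) → V)

/-- The fermionic Fock space `F_m = ⨁_{n=0}^m ⋀ⁿ ℂ^V`, with `⋀ⁿ ℂ^V` the space of antisymmetric
tensors in `(ℂ^V)^{⊗ n}`, and with the inner product of the tensor space. -/
def Fock (V : Type*) [Fintype V] : Submodule ℂ (EuclideanSpace ℂ (Word V)) where
  carrier := {ψ | ∀ (n : Fin (Fintype.card V + 1)) (w : Fin (n : ℕ) → V)
    (σ : Equiv.Perm (Fin (n : ℕ))),
    ψ ⟨n, w ∘ σ⟩ = ((Equiv.Perm.sign σ : ℤ) : ℂ) * ψ ⟨n, w⟩}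
  add_mem' := by
    intro φ ψ hφ hψ n w σ
    simp only [PiLp.add_apply, hφ n w σ, hψ n w σ]
    ring
  zero_mem' := by
    intro n w σ
    simp
  smul_mem' := by
    intro c ψ hψ n w σ
    simp only [PiLp.smul_apply, smul_eq_mul, hψ n w σ]
    ring

instance (V : Type*) [Fintype V] : InnerProductSpace ℂ (Fock V) :=
  Submodule.innerProductSpace (Fock V)

instance (V : Type*) [Fintype V] : CompleteSpace (Fock V) :=
  FiniteDimensional.complete ℂ _

section Fermions

variable {V : Type*} [Fintype V]

/-- The annihilation operator as a linear map: it contracts the first tensor factor with the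
unit vector of the mode `i`, `(a_i ψ)_n(w) = √(n+1) ψ_{n+1}(i, w)`. -/
def annihilateLin (i : V) : Fock V →ₗ[ℂ] Fock V where
  toFun ψ := ⟨WithLp.toLp 2 fun p : Word V =>
      if h : (p.1 : ℕ) + 1 < Fintype.card V + 1 then
        ((Real.sqrt ((p.1 : ℕ) + 1) : ℝ) : ℂ) *
          ψ.1 ⟨⟨(p.1 : ℕ) + 1, h⟩, (Fin.cons i p.2 : Fin ((p.1 : ℕ) + 1) → V)⟩
      else 0, by
    intro n w σ
    by_cases h : (n : ℕ) + 1 < Fintype.card V + 1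
    · have key := ψ.2 ⟨(n : ℕ) + 1, h⟩ (Fin.cons i w : Fin ((n : ℕ) + 1) → V)
        (Equiv.Perm.decomposeFin.symm (0, σ))
      have hcomp : (Fin.cons i w : Fin ((n : ℕ) + 1) → V) ∘
          (Equiv.Perm.decomposeFin.symm (0, σ)) = Fin.cons i (w ∘ σ) := by
        funext k
        refine Fin.cases ?_ (fun k => ?_) k <;> simp
      have hsign : Equiv.Perm.sign (Equiv.Perm.decomposeFin.symm (0, σ)) =
          Equiv.Perm.sign σ := by
        simp
      rw [hsign] at key
      rw [hcomp] at key
      simp only [h, dite_true]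
      rw [key]
      ring
    · simp only [h, dite_false, mul_zero]⟩
  map_add' φ ψ := by
    ext p
    simp only [Submodule.coe_add, PiLp.add_apply]
    split_ifs
    · ring
    · ring
  map_smul' c ψ := by
    ext p
    simp only [Submodule.coe_smul, PiLp.smul_apply, smul_eq_mul, RingHom.id_apply]
    split_ifs
    · ring
    · ring

/-- The annihilation operator `a_i`. -/
def annihilate (i : V) : Fock V →L[ℂ] Fock V :=
  LinearMap.toContinuousLinearMap (annihilateLin i)

/-- The Majorana operator `γ_i = a_i + a_i†`. -/
def majorana (i : V) : Fock V →L[ℂ] Fock V :=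
  annihilate i + star (annihilate i)

/-- The second Majorana operator `γ̄_i = (a_i - a_i†) / i`. -/
def majoranaBar (i : V) : Fock V →L[ℂ] Fock V :=
  (-Complex.I) • (annihilate i - star (annihilate i))

/-- The fermionic edge operator `E_{jk} = -i γ_j γ_k`. -/
def fermiEdge (j k : V) : Fock V →L[ℂ] Fock V :=
  (-Complex.I) • (majorana j * majorana k)

/-- The fermionic vertex operator `V_j = -i γ_j γ̄_j`. -/
def fermiVertex (j : V) : Fock V →L[ℂ] Fock V :=
  (-Complex.I) • (majorana j * majoranaBar j)

end Fermions

/-! ### Qubits and Pauli operators -/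

/-- The Hilbert space `(ℂ²)^{⊗ Q}` of the qubits indexed by `Q`, in its computational basis. -/
abbrev QubitSpace (Q : Type*) [Fintype Q] [DecidableEq Q] : Type _ :=
  EuclideanSpace ℂ (Q → Fin 2)

/-- The operator acting as the `2 × 2` matrix `M` on the qubit `q`, and trivially on all
other qubits. -/
def siteOp {Q : Type*} [Fintype Q] [DecidableEq Q] (q : Q) (M : Matrix (Fin 2) (Fin 2) ℂ) :
    QubitSpace Q →L[ℂ] QubitSpace Q :=
  Matrix.toEuclideanCLM (n := Q → Fin 2) (𝕜 := ℂ)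
    (Matrix.of fun s t => if ∀ r, r ≠ q → s r = t r then M (s q) (t q) else 0)

/-- Pauli matrices. -/
def pauliX : Matrix (Fin 2) (Fin 2) ℂ := !![0, 1; 1, 0]

def pauliY : Matrix (Fin 2) (Fin 2) ℂ := !![0, -Complex.I; Complex.I, 0]

def pauliZ : Matrix (Fin 2) (Fin 2) ℂ := !![1, 0; 0, -1]

/-! ### The square lattice

The point `(x, y)` lies in column `x` and row `y`; `y` increases upwards. The parameters `a b`
are the position of the lattice's lower left vertex inside the pattern of labels and arrows of the
infinite plane (only their parities matter). They range over both checkerboard labellings and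
both senses of circulation. -/

/-- Vertices of the `L₁ × L₂` lattice. -/
abbrev Vertex (L₁ L₂ : ℕ) : Type := Fin L₁ × Fin L₂

/-- Faces, named by their lower left vertex. -/
abbrev Face (L₁ L₂ : ℕ) : Type := Fin (L₁ - 1) × Fin (L₂ - 1)

variable {L₁ L₂ : ℕ}

/-- `u` is one of the four vertices of the face `f`. -/
def Face.HasVertex (f : Face L₁ L₂) (u : Vertex L₁ L₂) : Prop :=
  ((u.1 : ℕ) = f.1 ∨ (u.1 : ℕ) = f.1 + 1) ∧ ((u.2 : ℕ) = f.2 ∨ (u.2 : ℕ) = f.2 + 1)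

/-- The faces labelled odd in the checkerboard labelling. -/
abbrev IsOddFace (a b : ℕ) (f : Face L₁ L₂) : Prop :=
  Even ((f.1 : ℕ) + a + ((f.2 : ℕ) + b))

/-- There is a lattice edge, with its arrow pointing from `u` to `w`. Horizontal edges point left
and right in alternate rows, vertical edges point down and up in alternate columns. The arrows
circulate around every even face, clockwise and counterclockwise in alternate rows of faces; at
the vertices of an odd face `f`, the two edges of `f` both point in or both point out. -/
def Arrow (a b : ℕ) (u w : Vertex L₁ L₂) : Prop :=
  (u.2 = w.2 ∧ if Even ((u.2 : ℕ) + b) then (u.1 : ℕ) = w.1 + 1 else (w.1 : ℕ) = u.1 + 1) ∨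
  (u.1 = w.1 ∧ if Even ((u.1 : ℕ) + a) then (u.2 : ℕ) = w.2 + 1 else (w.2 : ℕ) = u.2 + 1)

/-- `u` and `w` are joined by a lattice edge. -/
def LatticeAdj (u w : Vertex L₁ L₂) : Prop :=
  (u.2 = w.2 ∧ ((u.1 : ℕ) = w.1 + 1 ∨ (w.1 : ℕ) = u.1 + 1)) ∨
  (u.1 = w.1 ∧ ((u.2 : ℕ) = w.2 + 1 ∨ (w.2 : ℕ) = u.2 + 1))

/-! ### The compact encoding -/

/-- One qubit for every vertex and one for every odd face. -/
abbrev Qubit (L₁ L₂ a b : ℕ) : Type :=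
  Vertex L₁ L₂ ⊕ {f : Face L₁ L₂ // IsOddFace a b f}

/-- Operators on the space of all qubits of the encoding. -/
abbrev QubitOp (L₁ L₂ a b : ℕ) : Type :=
  QubitSpace (Qubit L₁ L₂ a b) →L[ℂ] QubitSpace (Qubit L₁ L₂ a b)

/-- `M` on the qubit of the vertex `u`. -/
def vertexSite (a b : ℕ) (u : Vertex L₁ L₂) (M : Matrix (Fin 2) (Fin 2) ℂ) :
    QubitOp L₁ L₂ a b :=
  siteOp (Sum.inl u) M

open Classical in
/-- `M` on the qubit of the (unique) odd face adjacent to the edge `uw`; the identity if the edge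
is a boundary edge which is not adjacent to an odd face. -/
def faceSite (a b : ℕ) (u w : Vertex L₁ L₂) (M : Matrix (Fin 2) (Fin 2) ℂ) :
    QubitOp L₁ L₂ a b :=
  if h : ∃ f : {f : Face L₁ L₂ // IsOddFace a b f}, f.1.HasVertex u ∧ f.1.HasVertex w then
    siteOp (Sum.inr h.choose) M
  else 1

/-- The encoded edge operator of an edge with its arrow pointing from `u` to `w`:
`X_u Y_w Y_f` if it is horizontal, `X_u Y_w X_f` if it points down, `-X_u Y_w X_f` if it points
up. -/
def arrowOp (a b : ℕ) (u w : Vertex L₁ L₂) : QubitOp L₁ L₂ a b :=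
  if u.2 = w.2 then
    vertexSite a b u pauliX * vertexSite a b w pauliY * faceSite a b u w pauliY
  else if w.2 < u.2 then
    vertexSite a b u pauliX * vertexSite a b w pauliY * faceSite a b u w pauliX
  else
    -(vertexSite a b u pauliX * vertexSite a b w pauliY * faceSite a b u w pauliX)

open Classical in
/-- The encoded edge operators `Ẽ_{uw}`, with `Ẽ_{wu} = -Ẽ_{uw}` (and the default value `0` if
`u` and `w` are not adjacent). -/
def edgeOp (a b : ℕ) (u w : Vertex L₁ L₂) : QubitOp L₁ L₂ a b :=
  if Arrow a b u w then arrowOp a b u w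
  else if Arrow a b w u then -arrowOp a b w u
  else 0

/-- The encoded vertex operators `Ṽ_u = Z_u`. -/
def vertexOp (a b : ℕ) (u : Vertex L₁ L₂) : QubitOp L₁ L₂ a b :=
  vertexSite a b u pauliZ

/-- The vertex of the face `f` with offset `(s, t)`, `s, t ∈ {0, 1}`, from its lower left one. -/
def Face.corner (f : Face L₁ L₂) (s t : Fin 2) : Vertex L₁ L₂ :=
  (⟨f.1 + s, by have := f.1.2; have := s.2; omega⟩,
   ⟨f.2 + t, by have := f.2.2; have := t.2; omega⟩)

/-- The cycle operator `i⁴ Ẽ_{p₁p₂} Ẽ_{p₂p₃} Ẽ_{p₃p₄} Ẽ_{p₄p₁}` of the boundary cycle of a face. -/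
def cycleOp (a b : ℕ) (f : Face L₁ L₂) : QubitOp L₁ L₂ a b :=
  Complex.I ^ 4 •
    (edgeOp a b (f.corner 0 0) (f.corner 1 0) * edgeOp a b (f.corner 1 0) (f.corner 1 1) *
      edgeOp a b (f.corner 1 1) (f.corner 0 1) * edgeOp a b (f.corner 0 1) (f.corner 0 0))

/-- The code space `𝓛`: the joint `+1` eigenspace of the cycle operators that are nontrivial, i.e.
different from the identity. -/
def codeSpace (L₁ L₂ a b : ℕ) : Submodule ℂ (QubitSpace (Qubit L₁ L₂ a b)) where
  carrier := {ψ | ∀ f : Face L₁ L₂, cycleOp a b f ≠ 1 → cycleOp a b f ψ = ψ}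
  add_mem' := by
    intro φ ψ hφ hψ f hf
    rw [map_add, hφ f hf, hψ f hf]
  zero_mem' := by
    intro f _
    rw [map_zero]
  smul_mem' := by
    intro c ψ hψ f hf
    rw [map_smul, hψ f hf]

instance (L₁ L₂ a b : ℕ) : InnerProductSpace ℂ (codeSpace L₁ L₂ a b) :=
  Submodule.innerProductSpace (codeSpace L₁ L₂ a b)

instance (L₁ L₂ a b : ℕ) : CompleteSpace (codeSpace L₁ L₂ a b) :=
  FiniteDimensional.complete ℂ _

/-- `c` is one of the corner vertices of the lattice, and no even face touches it. -/
def IsOddCorner (a b : ℕ) (c : Vertex L₁ L₂) : Prop :=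
  ((c.1 : ℕ) = 0 ∨ (c.1 : ℕ) + 1 = L₁) ∧ ((c.2 : ℕ) = 0 ∨ (c.2 : ℕ) + 1 = L₂) ∧
    ∀ f : Face L₁ L₂, f.HasVertex c → IsOddFace a b f

open Classical in
/-- The encoded Majorana operator at a corner: `X_c` if the arrows point into the corner, `Y_c`
otherwise. -/
def cornerMajorana (a b : ℕ) (c : Vertex L₁ L₂) : QubitOp L₁ L₂ a b :=
  if ∃ u, Arrow a b u c then vertexSite a b c pauliX else vertexSite a b c pauliY

end CompactEncoding

end

open CompactEncoding

/-! The proof separates an abstract statement about fermions on a graph from a computation with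
Pauli operators.

Abstract part. Suppose operators `E j k`, `N j` have the relations of fermionic edge and vertex
operators (`IsEdgeVertex`: Hermitian involutions, `E k j = -E j k`, and commutation signs that count
common vertices), and `g` has those of a Majorana operator at one vertex `c` (`IsMajorana`). Since
`E_{jk} = -iγ_jγ_k` forces `γ_k = iγ_jE_{jk}`, the operator `g` can be transported along edges. On a
rectangle this is independent of the path as soon as the product around every face is `1`, because a
flat connection has a potential (`exists_potential`, `exists_majorana_of_faces`). The transported
operators anticommute (`isMajoranaFamily_of_step`), and `a_j = γ_j(1 - V_j)/2` satisfies the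
canonical anticommutation relations. A representation of these relations on a space of dimension `2
^ m` contains a vacuum, the states created from it form an orthonormal basis, and their amplitudes
give a unitary onto the Fock space (`IsCAR.exists_fock_equiv`). Conjugation by its inverse is `μ`.

Pauli part. For arrows `u → w` and `u' → w'`, the factors `X_u Y_w` and `X_u' Y_w'` yield the
required sign when the head of one is the tail of the other, but not for a common tail or head. The
face qubit repairs this: perpendicular arrows with a common tail or head border a common odd face,
where one carries `Y` and the other `X`; parallel ones with a common tail or head coincide
(`arrowOp_sComm`). Around an odd face all Pauli factors cancel and the signs multiply to `1`
(`cycleOp_eq_one`). Around an even face the arrows circulate, so `X` at a corner anticommutes with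
the cycle operator. This makes the even cycle operators nontrivial and independent, and each halves
the dimension (`finrank_codeSpace`). The cycle operators commute with all encoded operators, since a
cycle uses two edges at each of its vertices. Evenness of `n_F` makes exactly half of the faces even
and provides an odd corner. There the arrows all point in or all point out, so a single `X` or `Y`
is a Majorana operator (`isMajorana_cornerMajorana`). -/

noncomputable section
namespace CompactEncoding

/-! ### Enumerating finite sets of modes -/

section Words

variable {V : Type*}

/-- The elements of a finite set, listed in some order. -/
def enumerate (S : Finset V) : Fin S.card → V := fun k => (S.equivFin.symm k : V)

lemma enumerate_injective (S : Finset V) : Function.Injective (enumerate S) :=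
  Subtype.val_injective.comp S.equivFin.symm.injective

lemma enumerate_mem (S : Finset V) (k : Fin S.card) : enumerate S k ∈ S :=
  (S.equivFin.symm k).2

lemma exists_enumerate_eq {S : Finset V} {x : V} (hx : x ∈ S) : ∃ k, enumerate S k = x :=
  ⟨S.equivFin ⟨x, hx⟩, by simp [enumerate]⟩

lemma exists_perm_enumerate {S : Finset V} {w : Fin S.card → V} (hw : Function.Injective w)
    (hS : ∀ k, w k ∈ S) : ∃ σ : Equiv.Perm (Fin S.card), w = enumerate S ∘ σ := by
  have hinj : Function.Injective fun k => S.equivFin ⟨w k, hS k⟩ := by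
    intro k l h
    have := S.equivFin.injective h
    exact hw (by simpa using this)
  refine ⟨Equiv.ofBijective _ (Finite.injective_iff_bijective.1 hinj), ?_⟩
  funext k
  simp [enumerate]

variable [Fintype V]

/-- The enumeration of a finite set of modes as a word. -/
def setWord (S : Finset V) : Word V :=
  ⟨⟨S.card, Nat.lt_succ_of_le (Finset.card_le_univ S)⟩, enumerate S⟩

/-- A permutation of the enumeration of a finite set of modes as a word. -/
def permWord (S : Finset V) (σ : Equiv.Perm (Fin S.card)) : Word V :=
  ⟨⟨S.card, Nat.lt_succ_of_le (Finset.card_le_univ S)⟩, enumerate S ∘ σ⟩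

lemma exists_permWord [DecidableEq V] (p : Word V) (hp : Function.Injective p.2) :
    ∃ σ, p = permWord (Finset.univ.image p.2) σ := by
  obtain ⟨⟨n, hn⟩, w⟩ := p
  -- A free variable `S` in place of the image of `w` allows `n` to be replaced by `S.card`; the
  -- image itself depends on `n`.
  have key : ∀ S : Finset V, Finset.univ.image w = S →
      ∃ σ, (⟨⟨n, hn⟩, w⟩ : Word V) = permWord S σ := by
    intro S hS
    have hc : n = S.card := by
      rw [← hS, Finset.card_image_of_injective _ hp]
      simp
    subst hc
    obtain ⟨σ, hσ⟩ := exists_perm_enumerate (S := S) (w := w) hp (fun k => by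
      rw [← hS]; exact Finset.mem_image_of_mem _ (Finset.mem_univ _))
    exact ⟨σ, by subst hσ; rfl⟩
  exact key _ rfl

lemma image_permWord [DecidableEq V] (S : Finset V) (σ : Equiv.Perm (Fin S.card)) :
    Finset.univ.image (permWord S σ).2 = S := by
  apply Finset.eq_of_subset_of_card_le
  · intro x hx
    obtain ⟨k, -, rfl⟩ := Finset.mem_image.1 hx
    exact enumerate_mem S _
  · rw [Finset.card_image_of_injective]
    · exact (Finset.card_fin _).ge
    · exact (enumerate_injective S).comp σ.injective

lemma permWord_injective (S : Finset V) : Function.Injective (permWord S) := by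
  intro σ τ h
  have h2 : enumerate S ∘ σ = enumerate S ∘ τ := by
    simpa [permWord] using h
  ext k
  have := enumerate_injective S (congrFun h2 k)
  rw [this]

/-- Summation over all words of a function which vanishes on words with repetitions and does not
depend on the order of the letters. -/
lemma sum_word_eq_sum_finset [DecidableEq V] (F : Word V → ℝ)
    (h0 : ∀ p : Word V, ¬ Function.Injective p.2 → F p = 0)
    (hperm : ∀ S σ, F (permWord S σ) = F (setWord S)) :
    ∑ p, F p = ∑ S : Finset V, (S.card.factorial : ℝ) * F (setWord S) := by
  rw [← Finset.sum_fiberwise Finset.univ (fun p : Word V => Finset.univ.image p.2)]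
  refine Finset.sum_congr rfl fun S _ => ?_
  have hc : (S.card.factorial : ℝ) * F (setWord S) =
      ∑ _σ : Equiv.Perm (Fin S.card), F (setWord S) := by
    simp [Finset.card_univ, Fintype.card_perm]
  rw [hc]
  symm
  apply Finset.sum_of_injOn (permWord S) ((permWord_injective S).injOn)
  · intro σ _
    simpa using image_permWord S σ
  · intro p hp hnot
    apply h0
    intro hinj
    apply hnot
    obtain ⟨σ, hσ⟩ := exists_permWord p hinj
    have hS : Finset.univ.image p.2 = S := by simpa using hp
    subst hS
    exact ⟨σ, by simp, hσ.symm⟩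
  · intro σ _
    exact (hperm S σ).symm

end Words

/-! ### The dimension of the Fock space -/

section FockDim

variable {V : Type*} [Fintype V]

lemma Fock.apply_eq_zero (ψ : Fock V) (p : Word V) (hp : ¬ Function.Injective p.2) :
    ψ.1 p = 0 := by
  obtain ⟨n, w⟩ := p
  simp only [Function.Injective, not_forall] at hp
  obtain ⟨k, l, hkl, hne⟩ := hp
  have h := ψ.2 n w (Equiv.swap k l)
  have hw : w ∘ (Equiv.swap k l) = w := by
    funext i
    rcases eq_or_ne i k with rfl | hik
    · simp [hkl]
    · rcases eq_or_ne i l with rfl | hil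
      · simp [hkl]
      · simp [Equiv.swap_apply_of_ne_of_ne hik hil]
  rw [hw, Equiv.Perm.sign_swap hne] at h
  have h2 : (2 : ℂ) * ψ.1 ⟨n, w⟩ = 0 := by
    push_cast at h
    linear_combination h
  simpa using h2

lemma Fock.apply_permWord (ψ : Fock V) (S : Finset V) (σ : Equiv.Perm (Fin S.card)) :
    ψ.1 (permWord S σ) = ((Equiv.Perm.sign σ : ℤ) : ℂ) * ψ.1 (setWord S) :=
  ψ.2 ⟨S.card, Nat.lt_succ_of_le (Finset.card_le_univ S)⟩ (enumerate S) σ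

/-- An antisymmetric tensor vanishes on words with repetitions, and its other entries are determined
up to sign by one ordering of each set of modes. The upper bound suffices: `IsCAR.exists_fock_equiv`
supplies the opposite inequality by an injection. -/
lemma finrank_fock_le : Module.finrank ℂ (Fock V) ≤ 2 ^ Fintype.card V := by
  classical
  let R : Fock V →ₗ[ℂ] (Finset V → ℂ) :=
    { toFun := fun ψ S => ψ.1 (setWord S)
      map_add' := fun φ ψ => by ext S; simp
      map_smul' := fun c ψ => by ext S; simp }
  have hR : Function.Injective R := by
    rw [← LinearMap.ker_eq_bot, LinearMap.ker_eq_bot']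
    intro ψ hψ
    ext p
    by_cases hp : Function.Injective p.2
    · obtain ⟨σ, hσ⟩ := exists_permWord p hp
      have h1 := congrFun hψ (Finset.univ.image p.2)
      rw [hσ]
      have h2 : ψ.1 (setWord (Finset.univ.image p.2)) = 0 := h1
      rw [Fock.apply_permWord, h2]
      simp
    · rw [Fock.apply_eq_zero ψ p hp]
      simp
  have := LinearMap.finrank_le_finrank_of_injective hR
  simpa [Module.finrank_fintype_fun_eq_card] using this

end FockDim

lemma eq_zero_of_eq_neg_self {M : Type*} [AddCommGroup M] [Module ℂ M] {x : M} (h : x = -x) :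
    x = 0 := by
  have h2 : (2 : ℂ) • x = 0 := by
    rw [two_smul]
    nth_rewrite 1 [h]
    simp
  simpa using h2

/-! ### Canonical anticommutation relations -/

section CAR

variable {V : Type*} [DecidableEq V]
variable {H : Type*} [NormedAddCommGroup H] [InnerProductSpace ℂ H] [CompleteSpace H]

/-- The canonical anticommutation relations. -/
structure IsCAR (A : V → H →L[ℂ] H) : Prop where
  anticomm : ∀ i j, A i * A j + A j * A i = 0
  anticomm_star : ∀ i j, A i * star (A j) + star (A j) * A i = if i = j then 1 else 0

/-- The state created from `Ω` by the modes of a list. -/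
def created (A : V → H →L[ℂ] H) (Ω : H) (l : List V) : H :=
  l.foldr (fun i φ => star (A i) φ) Ω

omit [DecidableEq V] in
lemma created_cons (A : V → H →L[ℂ] H) (Ω : H) (i : V) (l : List V) :
    created A Ω (i :: l) = star (A i) (created A Ω l) := rfl

omit [DecidableEq V] in
lemma created_eq_prod (A : V → H →L[ℂ] H) (Ω : H) (l : List V) :
    created A Ω l = (l.map fun i => star (A i)).prod Ω := by
  induction l with
  | nil => rfl
  | cons i l ih => rw [created_cons, ih]; simp

namespace IsCAR

variable {A : V → H →L[ℂ] H} (hA : IsCAR A)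
include hA

lemma apply_anticomm (i j : V) (φ : H) : A i (A j φ) = -A j (A i φ) := by
  have := congrArg (fun T => T φ) (hA.anticomm i j)
  exact eq_neg_of_add_eq_zero_left this

lemma apply_star (i j : V) (φ : H) :
    A i (star (A j) φ) = (if i = j then φ else 0) - star (A j) (A i φ) := by
  have := congrArg (fun T => T φ) (hA.anticomm_star i j)
  rw [eq_sub_iff_add_eq]
  split_ifs at this ⊢ with h <;> exact this

lemma star_anticomm (i j : V) : star (A i) * star (A j) + star (A j) * star (A i) = 0 := by
  have := congrArg star (hA.anticomm j i)
  simpa using this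

lemma star_apply_anticomm (i j : V) (φ : H) :
    star (A i) (star (A j) φ) = -star (A j) (star (A i) φ) := by
  have := congrArg (fun T => T φ) (hA.star_anticomm i j)
  exact eq_neg_of_add_eq_zero_left this

lemma star_apply_self (i : V) (φ : H) : star (A i) (star (A i) φ) = 0 :=
  eq_zero_of_eq_neg_self (hA.star_apply_anticomm i i φ)

lemma apply_self (i : V) (φ : H) : A i (A i φ) = 0 :=
  eq_zero_of_eq_neg_self (hA.apply_anticomm i i φ)

/-- The modes are treated one at a time. If `A j` does not already kill the vector, it is replaced
by its image under `A j`: this is killed by `A j` since `A j` squares to zero, and by the earlier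
modes since the operators anticommute. -/
lemma exists_vacuum [Fintype V] [Nontrivial H] : ∃ Ω : H, ‖Ω‖ = 1 ∧ ∀ i, A i Ω = 0 := by
  have key : ∀ S : Finset V, ∃ Ω : H, Ω ≠ 0 ∧ ∀ i ∈ S, A i Ω = 0 := by
    intro S
    induction S using Finset.induction_on with
    | empty =>
      obtain ⟨x, hx⟩ := exists_ne (0 : H)
      exact ⟨x, hx, by simp⟩
    | insert j S _ ih =>
      obtain ⟨Ω, h0, hΩ⟩ := ih
      by_cases hj : A j Ω = 0
      · exact ⟨Ω, h0, by simpa [hj] using hΩ⟩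
      · refine ⟨A j Ω, hj, fun i hi => ?_⟩
        rcases Finset.mem_insert.1 hi with rfl | hi
        · exact hA.apply_self i Ω
        · rw [hA.apply_anticomm, hΩ i hi]; simp
  obtain ⟨Ω, h0, hΩ⟩ := key Finset.univ
  refine ⟨((‖Ω‖ : ℂ)⁻¹) • Ω, ?_, fun i => ?_⟩
  · rw [norm_smul]
    simp [h0]
  · rw [map_smul, hΩ i (Finset.mem_univ i), smul_zero]

variable {Ω : H} (hΩ : ∀ i, A i Ω = 0)

section
include hΩ

lemma apply_created_of_notMem {i : V} {l : List V} (hi : i ∉ l) : A i (created A Ω l) = 0 := by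
  induction l with
  | nil => exact hΩ i
  | cons j l ih =>
    rw [List.mem_cons, not_or] at hi
    rw [created_cons, hA.apply_star, if_neg hi.1, ih hi.2]
    simp

lemma norm_created (h1 : ‖Ω‖ = 1) {l : List V} (hl : l.Nodup) : ‖created A Ω l‖ = 1 := by
  induction l with
  | nil => exact h1
  | cons i l ih =>
    rw [List.nodup_cons] at hl
    have h : inner ℂ (star (A i) (created A Ω l)) (star (A i) (created A Ω l)) =
        inner ℂ (created A Ω l) (created A Ω l) := by
      nth_rewrite 1 [ContinuousLinearMap.star_eq_adjoint]
      rw [ContinuousLinearMap.adjoint_inner_left, hA.apply_star,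
        hA.apply_created_of_notMem hΩ hl.1]
      simp
    rw [created_cons, ← ih hl.2, norm_eq_sqrt_re_inner (𝕜 := ℂ), h,
      ← norm_eq_sqrt_re_inner (𝕜 := ℂ)]

end

lemma star_apply_created_of_mem {i : V} {l : List V} (hi : i ∈ l) :
    star (A i) (created A Ω l) = 0 := by
  induction l with
  | nil => simp at hi
  | cons j l ih =>
    rw [created_cons]
    rcases List.mem_cons.1 hi with rfl | hi
    · exact hA.star_apply_self i _
    · rw [hA.star_apply_anticomm, ih hi]; simp

lemma created_eq_zero {l : List V} (hl : ¬ l.Nodup) : created A Ω l = 0 := by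
  induction l with
  | nil => simp at hl
  | cons i l ih =>
    rw [created_cons]
    by_cases hi : i ∈ l
    · exact hA.star_apply_created_of_mem hi
    · rw [List.nodup_cons] at hl
      rw [ih (fun h => hl ⟨hi, h⟩), map_zero]

/-- The number operator of the mode `i` is self-adjoint and has eigenvalue `1` on the first state
and `0` on the second. -/
lemma inner_created_of_mem_of_notMem (hΩ : ∀ i, A i Ω = 0) {i : V} {l l' : List V} (hi : i ∈ l)
    (hi' : i ∉ l') : inner ℂ (created A Ω l) (created A Ω l') = 0 := by
  have h1 : star (A i) (A i (created A Ω l)) = created A Ω l := by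
    have := hA.apply_star i i (created A Ω l)
    rw [hA.star_apply_created_of_mem hi] at this
    simp only [map_zero, if_true] at this
    exact (sub_eq_zero.1 this.symm).symm
  rw [← h1, ContinuousLinearMap.star_eq_adjoint, ContinuousLinearMap.adjoint_inner_left,
    hA.apply_created_of_notMem hΩ hi', inner_zero_right]

/-- The creation operators anticommute, so every linear combination of them squares to zero and the
map `v ↦ ∑ v i • star (A i)` extends to the exterior algebra. The sign is then that of the
alternating map `ExteriorAlgebra.ιMulti`. -/
lemma created_perm [Fintype V] {n : ℕ} (w : Fin n → V) (σ : Equiv.Perm (Fin n)) :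
    created A Ω (List.ofFn (w ∘ σ)) =
      ((Equiv.Perm.sign σ : ℤ) : ℂ) • created A Ω (List.ofFn w) := by
  let f : (V → ℂ) →ₗ[ℂ] (H →L[ℂ] H) := Fintype.linearCombination ℂ (fun i => star (A i))
  have hf : ∀ v, f v * f v = 0 := by
    intro v
    have h1 : f v * f v = ∑ i, ∑ j, (v i * v j) • (star (A i) * star (A j)) := by
      simp only [f, Fintype.linearCombination_apply, Finset.sum_mul_sum, smul_mul_smul_comm]
    have h2 : f v * f v = - (f v * f v) := by
      conv_lhs => rw [h1, Finset.sum_comm]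
      rw [h1, ← Finset.sum_neg_distrib]
      refine Finset.sum_congr rfl fun i _ => ?_
      rw [← Finset.sum_neg_distrib]
      refine Finset.sum_congr rfl fun j _ => ?_
      rw [eq_neg_of_add_eq_zero_left (hA.star_anticomm j i), smul_neg, mul_comm]
    exact eq_zero_of_eq_neg_self h2
  have hw : ∀ u : Fin n → V, created A Ω (List.ofFn u) =
      ExteriorAlgebra.lift ℂ ⟨f, hf⟩
        (ExteriorAlgebra.ιMulti ℂ n (fun k => (Pi.single (u k) 1 : V → ℂ))) Ω := by
    intro u
    rw [created_eq_prod, ExteriorAlgebra.ιMulti_apply, map_list_prod, List.map_ofFn,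
      List.map_ofFn]
    congr 2
    congr 1
    funext k
    simp [f]
  rw [hw, hw]
  have := (ExteriorAlgebra.ιMulti ℂ n).map_perm (fun k => (Pi.single (w k) 1 : V → ℂ)) σ
  have h3 : (fun k => (Pi.single ((w ∘ σ) k) 1 : V → ℂ)) =
    (fun k => (Pi.single (w k) 1 : V → ℂ)) ∘ σ := rfl
  rw [h3, this]
  rcases Int.units_eq_one_or (Equiv.Perm.sign σ) with h | h <;> simp [h]

end IsCAR

end CAR

end CompactEncoding
end
noncomputable section
namespace CompactEncoding

/-! ### Uniqueness of the Fock representation -/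

section FockUnique

variable {V : Type*} [Fintype V] [DecidableEq V]
variable {H : Type*} [NormedAddCommGroup H] [InnerProductSpace ℂ H] [CompleteSpace H]

namespace IsCAR

variable {A : V → H →L[ℂ] H} (hA : IsCAR A) {Ω : H}
include hA

/-- The states `A†_S Ω` form an orthonormal basis. -/
lemma sum_norm_inner_created (hΩ : ∀ i, A i Ω = 0) (h1 : ‖Ω‖ = 1)
    (hdim : Module.finrank ℂ H = 2 ^ Fintype.card V) (φ : H) :
    ∑ S : Finset V, ‖inner ℂ (created A Ω (List.ofFn (enumerate S))) φ‖ ^ 2 = ‖φ‖ ^ 2 := by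
  have hmem : ∀ (S : Finset V) (i : V), i ∈ List.ofFn (enumerate S) ↔ i ∈ S := by
    intro S i
    rw [List.mem_ofFn]
    constructor
    · rintro ⟨k, rfl⟩
      exact enumerate_mem S k
    · intro hi
      exact exists_enumerate_eq hi
  have hon : Orthonormal ℂ fun S : Finset V => created A Ω (List.ofFn (enumerate S)) := by
    refine ⟨fun S => hA.norm_created hΩ h1 (List.nodup_ofFn.2 (enumerate_injective S)), ?_⟩
    intro S S' hne
    have : ∃ i, ¬ (i ∈ S ↔ i ∈ S') := by
      by_contra! h
      exact hne (Finset.ext h)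
    obtain ⟨i, hi⟩ := this
    by_cases hS : i ∈ S
    · have hS' : i ∉ S' := fun h => hi ⟨fun _ => h, fun _ => hS⟩
      exact hA.inner_created_of_mem_of_notMem hΩ ((hmem S i).2 hS) (fun h => hS' ((hmem S' i).1 h))
    · have hS' : i ∈ S' := by
        by_contra h
        exact hi ⟨fun h' => absurd h' hS, fun h' => absurd h' h⟩
      rw [← inner_conj_symm, hA.inner_created_of_mem_of_notMem hΩ ((hmem S' i).2 hS')
        (fun h => hS ((hmem S i).1 h)), map_zero]
  have : FiniteDimensional ℂ H := Module.finite_of_finrank_pos (by rw [hdim]; positivity)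
  have hspan : ⊤ ≤ Submodule.span ℂ
      (Set.range fun S : Finset V => created A Ω (List.ofFn (enumerate S))) := by
    rw [hon.linearIndependent.span_eq_top_of_card_eq_finrank' (by simp [hdim])]
  have h := (OrthonormalBasis.mk hon hspan).sum_sq_norm_inner_right φ
  simpa using h

variable (A Ω) in
omit hA in
/-- The amplitudes of a state in the occupation number representation. -/
def amplitudes (φ : H) : EuclideanSpace ℂ (Word V) :=
  WithLp.toLp 2 fun p =>
    ((Real.sqrt ((p.1 : ℕ).factorial) : ℝ) : ℂ)⁻¹ * inner ℂ (created A Ω (List.ofFn p.2)) φ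

/-- The `n!` orderings of a set of `n` modes contribute equally. The factor `1 / √n!` in
`amplitudes` compensates for this, and what remains is Parseval's identity for the created states.
-/
lemma norm_amplitudes (hΩ : ∀ i, A i Ω = 0) (h1 : ‖Ω‖ = 1)
    (hdim : Module.finrank ℂ H = 2 ^ Fintype.card V) (φ : H) :
    ‖amplitudes A Ω φ‖ = ‖φ‖ := by
  have h : ‖amplitudes A Ω φ‖ ^ 2 = ‖φ‖ ^ 2 := by
    rw [EuclideanSpace.norm_sq_eq, sum_word_eq_sum_finset]
    · rw [← hA.sum_norm_inner_created hΩ h1 hdim φ]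
      refine Finset.sum_congr rfl fun S _ => ?_
      have hS : amplitudes A Ω φ (setWord S) = ((Real.sqrt (S.card.factorial) : ℝ) : ℂ)⁻¹ *
        inner ℂ (created A Ω (List.ofFn (enumerate S))) φ := rfl
      rw [hS, norm_mul, norm_inv, Complex.norm_real, Real.norm_of_nonneg (Real.sqrt_nonneg _),
        mul_pow, inv_pow, Real.sq_sqrt (Nat.cast_nonneg _), ← mul_assoc, mul_inv_cancel₀, one_mul]
      exact_mod_cast Nat.factorial_ne_zero _
    · intro p hp
      have : created A Ω (List.ofFn p.2) = 0 := hA.created_eq_zero (by rwa [List.nodup_ofFn])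
      simp [amplitudes, this]
    · intro S σ
      have hS : amplitudes A Ω φ (setWord S) = ((Real.sqrt (S.card.factorial) : ℝ) : ℂ)⁻¹ *
        inner ℂ (created A Ω (List.ofFn (enumerate S))) φ := rfl
      have hp : amplitudes A Ω φ (permWord S σ) = ((Real.sqrt (S.card.factorial) : ℝ) : ℂ)⁻¹ *
        inner ℂ (created A Ω (List.ofFn (enumerate S ∘ σ))) φ := rfl
      rw [hS, hp, hA.created_perm]
      rcases Int.units_eq_one_or (Equiv.Perm.sign σ) with h | h <;> simp [h]
  exact (sq_eq_sq₀ (norm_nonneg _) (norm_nonneg _)).1 h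

lemma amplitudes_mem_fock (φ : H) : amplitudes A Ω φ ∈ Fock V := by
  intro n w σ
  have hp : amplitudes A Ω φ ⟨n, w ∘ σ⟩ = ((Real.sqrt ((n : ℕ).factorial) : ℝ) : ℂ)⁻¹ *
    inner ℂ (created A Ω (List.ofFn (w ∘ σ))) φ := rfl
  have hS : amplitudes A Ω φ ⟨n, w⟩ = ((Real.sqrt ((n : ℕ).factorial) : ℝ) : ℂ)⁻¹ *
    inner ℂ (created A Ω (List.ofFn w)) φ := rfl
  rw [hp, hS, hA.created_perm]
  rcases Int.units_eq_one_or (Equiv.Perm.sign σ) with h | h <;> simp [h]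

/-- Taking the adjoint, `A i` prepends the letter `i` to the word in the inner product, which is the
contraction defining `annihilateLin`. The normalisations agree because `√(n + 1) / √(n + 1)! = 1 /
√n!`. -/
lemma amplitudes_apply (i : V) (φ : H) :
    amplitudes A Ω (A i φ) = annihilateLin i ⟨amplitudes A Ω φ, hA.amplitudes_mem_fock φ⟩ := by
  ext p
  obtain ⟨n, w⟩ := p
  have hcons : inner ℂ (created A Ω (List.ofFn w)) (A i φ) =
      inner ℂ (created A Ω (List.ofFn (Fin.cons i w : Fin ((n : ℕ) + 1) → V))) φ := by
    rw [List.ofFn_succ, created_cons, ContinuousLinearMap.star_eq_adjoint,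
      Fin.cons_zero, ContinuousLinearMap.adjoint_inner_left]
    simp
  have hl : amplitudes A Ω (A i φ) ⟨n, w⟩ = ((Real.sqrt ((n : ℕ).factorial) : ℝ) : ℂ)⁻¹ *
    inner ℂ (created A Ω (List.ofFn (Fin.cons i w : Fin ((n : ℕ) + 1) → V))) φ := by
    rw [← hcons]; rfl
  rw [hl]
  by_cases h : (n : ℕ) + 1 < Fintype.card V + 1
  · have hr : (annihilateLin i ⟨amplitudes A Ω φ, hA.amplitudes_mem_fock φ⟩).1 ⟨n, w⟩ =
        ((Real.sqrt ((n : ℕ) + 1) : ℝ) : ℂ) *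
          (((Real.sqrt (((n : ℕ) + 1).factorial) : ℝ) : ℂ)⁻¹ *
          inner ℂ (created A Ω (List.ofFn (Fin.cons i w : Fin ((n : ℕ) + 1) → V))) φ) := by
      have : (annihilateLin i ⟨amplitudes A Ω φ, hA.amplitudes_mem_fock φ⟩).1 ⟨n, w⟩ =
        if h : (n : ℕ) + 1 < Fintype.card V + 1 then
        ((Real.sqrt ((n : ℕ) + 1) : ℝ) : ℂ) *
          amplitudes A Ω φ ⟨⟨(n : ℕ) + 1, h⟩, (Fin.cons i w : Fin ((n : ℕ) + 1) → V)⟩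
        else 0 := rfl
      rw [this, dif_pos h]
      rfl
    rw [hr, ← mul_assoc]
    congr 1
    rw [Nat.factorial_succ, Nat.cast_mul, Real.sqrt_mul (Nat.cast_nonneg _)]
    have h0 : ((Real.sqrt ((n : ℕ).factorial) : ℝ) : ℂ) ≠ 0 := by
      rw [Complex.ofReal_ne_zero]
      exact (Real.sqrt_pos.2 (by exact_mod_cast Nat.factorial_pos _)).ne'
    have h1 : ((Real.sqrt ((n : ℕ) + 1) : ℝ) : ℂ) ≠ 0 := by
      rw [Complex.ofReal_ne_zero]
      exact (Real.sqrt_pos.2 (by positivity)).ne'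
    push_cast
    field_simp
  · have hr : (annihilateLin i ⟨amplitudes A Ω φ, hA.amplitudes_mem_fock φ⟩).1 ⟨n, w⟩ = 0 := by
      have : (annihilateLin i ⟨amplitudes A Ω φ, hA.amplitudes_mem_fock φ⟩).1 ⟨n, w⟩ =
        if h : (n : ℕ) + 1 < Fintype.card V + 1 then
        ((Real.sqrt ((n : ℕ) + 1) : ℝ) : ℂ) *
          amplitudes A Ω φ ⟨⟨(n : ℕ) + 1, h⟩, (Fin.cons i w : Fin ((n : ℕ) + 1) → V)⟩
        else 0 := rfl
      rw [this, dif_neg h]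
    -- At the top particle number `annihilateLin` is `0` by definition. The other side vanishes as
    -- well, because a word with more letters than there are modes repeats one.
    rw [hr, hA.created_eq_zero, inner_zero_left, mul_zero]
    rw [List.nodup_ofFn]
    intro hinj
    have := Fintype.card_le_of_injective _ hinj
    rw [Fintype.card_fin] at this
    omega

/-- A representation of the canonical anticommutation relations of the smallest possible
dimension is unitarily equivalent to the Fock representation. -/
theorem exists_fock_equiv [FiniteDimensional ℂ H]
    (hdim : Module.finrank ℂ H = 2 ^ Fintype.card V) :
    ∃ T : H ≃ₗᵢ[ℂ] Fock V, ∀ i φ, T (A i φ) = annihilate i (T φ) := by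
  have : Nontrivial H := Module.nontrivial_of_finrank_pos (R := ℂ) (by rw [hdim]; positivity)
  obtain ⟨Ω, h1, hΩ⟩ := hA.exists_vacuum
  let T₀ : H →ₗ[ℂ] Fock V :=
    { toFun := fun φ => ⟨amplitudes A Ω φ, hA.amplitudes_mem_fock φ⟩
      map_add' := fun φ ψ => by
        ext p
        simp [amplitudes, mul_add]
      map_smul' := fun c φ => by
        ext p
        simp [amplitudes, mul_left_comm] }
  let T₁ : H →ₗᵢ[ℂ] Fock V := ⟨T₀, fun φ => hA.norm_amplitudes hΩ h1 hdim φ⟩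
  -- The isometry is only known to be injective; together with `finrank_fock_le` this forces equal
  -- dimensions, hence surjectivity.
  have hle : Module.finrank ℂ H ≤ Module.finrank ℂ (Fock V) :=
    LinearMap.finrank_le_finrank_of_injective T₁.injective
  have heq : Module.finrank ℂ H = Module.finrank ℂ (Fock V) :=
    le_antisymm hle (hdim ▸ finrank_fock_le)
  refine ⟨T₁.toLinearIsometryEquiv heq, fun i φ => ?_⟩
  exact Subtype.ext (hA.amplitudes_apply i φ)

end IsCAR

end FockUnique

end CompactEncoding
end
noncomputable section
namespace CompactEncoding

/-! ### Relations of edge, vertex and Majorana operators -/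

section Relations

/-- The sign `-1` on the diagonal and `1` off the diagonal. -/
def chi {V : Type*} [DecidableEq V] (j k : V) : ℂ := if j = k then -1 else 1

variable {V : Type*} [DecidableEq V]

@[simp] lemma chi_self (j : V) : chi j j = -1 := if_pos rfl

lemma chi_of_ne {j k : V} (h : j ≠ k) : chi j k = 1 := if_neg h

lemma chi_comm (j k : V) : chi j k = chi k j := by
  unfold chi
  simp only [eq_comm]

@[simp] lemma chi_mul_self (j k : V) : chi j k * chi j k = 1 := by
  unfold chi
  split_ifs <;> norm_num

variable {R : Type*} [Ring R] [StarRing R] [Algebra ℂ R]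

/-- The relations of the edge and vertex operators `E_{jk}`, `V_j` of fermions on a graph, apart
from those of the cycles. -/
structure IsEdgeVertex (adj : V → V → Prop) (E : V → V → R) (N : V → R) : Prop where
  symm : ∀ {j k}, adj j k → adj k j
  ne : ∀ {j k}, adj j k → j ≠ k
  edge_star : ∀ {j k}, adj j k → star (E j k) = E j k
  edge_sq : ∀ {j k}, adj j k → E j k * E j k = 1
  edge_swap : ∀ {j k}, adj j k → E k j = -E j k
  edge_comm : ∀ {j k l m}, adj j k → adj l m →
    E j k * E l m = (chi j l * chi j m * (chi k l * chi k m)) • (E l m * E j k)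
  vertex_star : ∀ j, star (N j) = N j
  vertex_sq : ∀ j, N j * N j = 1
  vertex_comm : ∀ j k, N j * N k = N k * N j
  vertex_edge : ∀ {l m}, adj l m → ∀ j, N j * E l m = (chi j l * chi j m) • (E l m * N j)

/-- The relations of the Majorana operator `g = γ_c` with the edge and vertex operators. -/
structure IsMajorana (adj : V → V → Prop) (E : V → V → R) (N : V → R) (c : V) (g : R) :
    Prop where
  star_eq : star g = g
  sq : g * g = 1
  edge : ∀ {l m}, adj l m → g * E l m = (chi c l * chi c m) • (E l m * g)
  vertex : ∀ j, g * N j = chi c j • (N j * g)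

variable {adj : V → V → Prop} {E : V → V → R} {N : V → R}

/-- The transport `γ_k = iγ_jE_{jk}`. The signs attached to `j` come once from `g` and once from the
edge, so they cancel and only those of `k` survive. The factor `i` restores self-adjointness and the
square `1`, since `g` and `E j k` anticommute. -/
lemma IsMajorana.step [StarModule ℂ R] (h : IsEdgeVertex adj E N) {j k : V} {g : R}
    (hg : IsMajorana adj E N j g) (hjk : adj j k) : IsMajorana adj E N k (Complex.I • (g * E j k)) := by
  have hgE : g * E j k = -(E j k * g) := by
    rw [hg.edge hjk, chi_self, chi_of_ne (h.ne hjk)]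
    simp
  have hgEg : g * E j k * g = -E j k := by
    rw [hgE, neg_mul, mul_assoc, hg.sq, mul_one]
  refine ⟨?_, ?_, ?_, ?_⟩
  · rw [star_smul, star_mul, h.edge_star hjk, hg.star_eq, hgE, smul_neg]
    simp
  · rw [smul_mul_smul_comm, ← mul_assoc, hgEg, neg_mul, h.edge_sq hjk]
    simp
  · intro l m hlm
    have e : g * E j k * E l m = (chi k l * chi k m) • (E l m * (g * E j k)) := by
      rw [mul_assoc, h.edge_comm hjk hlm, mul_smul_comm, ← mul_assoc g (E l m), hg.edge hlm,
        smul_mul_assoc, smul_smul, mul_assoc (E l m)]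
      congr 1
      linear_combination (chi k l * chi k m * (chi j l * chi j l)) * chi_mul_self j m +
        (chi k l * chi k m) * chi_mul_self j l
    rw [smul_mul_assoc, e, smul_comm, mul_smul_comm]
  · intro i
    have hN : E j k * N i = (chi i j * chi i k) • (N i * E j k) := by
      rw [h.vertex_edge hjk, smul_smul]
      have : chi i j * chi i k * (chi i j * chi i k) = 1 := by
        linear_combination (chi i k * chi i k) * chi_mul_self i j + chi_mul_self i k
      rw [this, one_smul]
    have e : g * E j k * N i = chi k i • (N i * (g * E j k)) := by
      rw [mul_assoc, hN, mul_smul_comm, ← mul_assoc g (N i), hg.vertex, smul_mul_assoc, smul_smul,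
        mul_assoc (N i)]
      congr 1
      rw [chi_comm j i, chi_comm k i]
      linear_combination (chi i k) * chi_mul_self i j
    rw [smul_mul_assoc, e, smul_comm, mul_smul_comm]

/-- Majorana operators at all vertices of a connected graph, related by the edge operators. -/
structure IsMajoranaFamily (adj : V → V → Prop) (E : V → V → R) (N : V → R) (G : V → R) :
    Prop where
  isMajorana : ∀ j, IsMajorana adj E N j (G j)
  step : ∀ {j k}, adj j k → G k = Complex.I • (G j * E j k)
  comm : ∀ j k, G j * G k = -(chi j k • (G k * G j))

/-- Two inductions along edges: one carries the Majorana relations from `c` to every vertex, the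
other, for fixed `j`, carries the commutation sign of `G j` from `G k` to a neighbour. It starts at
`k = j`, where `chi j j = -1` makes the claim trivial. -/
lemma isMajoranaFamily_of_step [StarModule ℂ R] (h : IsEdgeVertex adj E N)
    (hconn : ∀ (c : V) (P : V → Prop), P c → (∀ j k, adj j k → P j → P k) → ∀ j, P j)
    {G : V → R} {c : V} (hc : IsMajorana adj E N c (G c))
    (hstep : ∀ {j k}, adj j k → G k = Complex.I • (G j * E j k)) :
    IsMajoranaFamily adj E N G := by
  have hmaj : ∀ j, IsMajorana adj E N j (G j) := by
    refine hconn c _ hc fun j k hjk hj => ?_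
    rw [hstep hjk]
    exact hj.step h hjk
  refine ⟨hmaj, hstep, fun j => ?_⟩
  refine hconn j _ ?_ fun k l hkl hk => ?_
  · simp
  · have e : G j * G k * E k l = -(chi j l • (G k * E k l * G j)) := by
      rw [hk, neg_mul, smul_mul_assoc, mul_assoc (G k), (hmaj j).edge hkl, mul_smul_comm,
        smul_smul, ← mul_assoc (G k)]
      congr 2
      linear_combination (chi j l) * chi_mul_self j k
    rw [hstep hkl, mul_smul_comm, ← mul_assoc, e, smul_mul_assoc, smul_comm (chi j l), smul_neg]

namespace IsMajoranaFamily

variable {G : V → R} (hG : IsMajoranaFamily adj E N G)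
include hG

lemma edge_eq {j k : V} (hjk : adj j k) : (-Complex.I) • (G j * G k) = E j k := by
  rw [hG.step hjk, mul_smul_comm, ← mul_assoc, (hG.isMajorana j).sq, one_mul, smul_smul]
  simp

lemma vertex_anticomm (j : V) : N j * G j = -(G j * N j) := by
  rw [(hG.isMajorana j).vertex, chi_self]
  simp

lemma vertex_comm {j k : V} (hjk : j ≠ k) : Commute (G j) (N k) := by
  have := (hG.isMajorana j).vertex k
  rwa [chi_of_ne hjk, one_smul] at this

/-- The annihilation operators built from Majorana and vertex operators. -/
def _root_.CompactEncoding.lowering (G N : V → R) (j : V) : R :=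
  (1 / 2 : ℂ) • (G j * (1 - N j))

variable [StarModule ℂ R]

lemma star_lowering (h : IsEdgeVertex adj E N) (j : V) :
    star (lowering G N j) = (1 / 2 : ℂ) • ((1 - N j) * G j) := by
  rw [lowering, star_smul, star_mul, star_sub, star_one, h.vertex_star, (hG.isMajorana j).star_eq]
  simp

/-- This and the next identity justify the form of `lowering`: `V_j = -iγ_jγ̄_j` means `iγ̄_j =
-γ_jV_j`, hence `a_j = (γ_j + iγ̄_j)/2 = γ_j(1 - V_j)/2`. -/
lemma lowering_add_star (h : IsEdgeVertex adj E N) (j : V) :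
    lowering G N j + star (lowering G N j) = G j := by
  have e : G j * (1 - N j) + (1 - N j) * G j = (2 : ℂ) • G j := by
    rw [mul_sub, sub_mul, hG.vertex_anticomm, two_smul]
    noncomm_ring
  rw [hG.star_lowering h, lowering, ← smul_add, e, smul_smul]
  norm_num

lemma lowering_sub_star (h : IsEdgeVertex adj E N) (j : V) :
    lowering G N j - star (lowering G N j) = -(G j * N j) := by
  have e : G j * (1 - N j) - (1 - N j) * G j = (2 : ℂ) • -(G j * N j) := by
    rw [mul_sub, sub_mul, hG.vertex_anticomm, two_smul]
    noncomm_ring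
  rw [hG.star_lowering h, lowering, ← smul_sub, e, smul_smul]
  norm_num

lemma vertex_eq (h : IsEdgeVertex adj E N) (j : V) :
    (-Complex.I) • ((lowering G N j + star (lowering G N j)) *
      ((-Complex.I) • (lowering G N j - star (lowering G N j)))) = N j := by
  rw [hG.lowering_add_star h, hG.lowering_sub_star h, mul_smul_comm, mul_neg, ← mul_assoc,
    (hG.isMajorana j).sq, one_mul, smul_smul]
  simp

omit [StarModule ℂ R] in
-- On the diagonal, moving `G j` past `1 - N j` turns it into `1 + N j`, and `(1 + N j)(1 - N j) =
-- 0`. Off the diagonal the vertex factors commute with everything at the other vertex, so the sign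
-- is that of the Majorana operators.
lemma lowering_anticomm (h : IsEdgeVertex adj E N) (j k : V) :
    lowering G N j * lowering G N k + lowering G N k * lowering G N j = 0 := by
  rw [lowering, lowering, smul_mul_smul_comm, smul_mul_smul_comm, ← smul_add]
  rcases eq_or_ne j k with rfl | hjk
  · have : G j * (1 - N j) * (G j * (1 - N j)) = 0 := by
      have h1 : (1 - N j) * G j = G j * (1 + N j) := by
        rw [sub_mul, hG.vertex_anticomm]
        noncomm_ring
      have h2 : (1 + N j) * (1 - N j) = 1 - N j * N j := by noncomm_ring
      rw [mul_assoc, ← mul_assoc (1 - N j), h1, mul_assoc, h2, h.vertex_sq]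
      simp
    rw [this]
    simp
  · have h1 : G k * G j = -(G j * G k) := by
      rw [hG.comm k j, chi_of_ne hjk.symm, one_smul]
    have hjk' : Commute (G k) (1 - N j) := (Commute.one_right _).sub_right (hG.vertex_comm hjk.symm)
    have hkj' : Commute (G j) (1 - N k) := (Commute.one_right _).sub_right (hG.vertex_comm hjk)
    have hNN : Commute (1 - N j) (1 - N k) :=
      ((Commute.one_right _).sub_right
        ((Commute.one_left _).sub_left (h.vertex_comm j k)))
    have e1 : G j * (1 - N j) * (G k * (1 - N k)) = G j * G k * ((1 - N j) * (1 - N k)) := by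
      rw [mul_assoc, ← mul_assoc (1 - N j), ← hjk'.eq]
      simp only [mul_assoc]
    have e2 : G k * (1 - N k) * (G j * (1 - N j)) = G k * G j * ((1 - N j) * (1 - N k)) := by
      rw [mul_assoc, ← mul_assoc (1 - N k), ← hkj'.eq, hNN.eq]
      simp only [mul_assoc]
    rw [e1, e2, h1]
    simp

/-- On the diagonal the two products are `(1 + N j)² / 4` and `(1 - N j)² / 4`, with sum `(1 + (N
j)²) / 2 = 1`. -/
lemma lowering_anticomm_star (h : IsEdgeVertex adj E N) (j k : V) :
    lowering G N j * star (lowering G N k) + star (lowering G N k) * lowering G N j =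
      if j = k then 1 else 0 := by
  rw [hG.star_lowering h, lowering, smul_mul_smul_comm, smul_mul_smul_comm, ← smul_add]
  rcases eq_or_ne j k with rfl | hjk
  · have h1 : (1 - N j) * G j = G j * (1 + N j) := by
      rw [sub_mul, hG.vertex_anticomm]
      noncomm_ring
    have h3 : (1 + N j) * G j = G j * (1 - N j) := by
      rw [add_mul, hG.vertex_anticomm]
      noncomm_ring
    have e1 : G j * (1 - N j) * ((1 - N j) * G j) = (1 + N j) * (1 + N j) := by
      rw [← h3, h1, mul_assoc, ← mul_assoc (G j), (hG.isMajorana j).sq, one_mul]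
    have e2 : (1 - N j) * G j * (G j * (1 - N j)) = (1 - N j) * (1 - N j) := by
      rw [mul_assoc, ← mul_assoc (G j), (hG.isMajorana j).sq, one_mul]
    have e3 : (1 + N j) * (1 + N j) + (1 - N j) * (1 - N j) = (2 : ℂ) • (1 + N j * N j) := by
      rw [two_smul]
      noncomm_ring
    rw [e1, e2, e3, h.vertex_sq, if_pos rfl, ← two_smul ℂ, smul_smul, smul_smul]
    norm_num
  · have h1 : G k * G j = -(G j * G k) := by
      rw [hG.comm k j, chi_of_ne hjk.symm, one_smul]
    have hjk' : Commute (G k) (1 - N j) := (Commute.one_right _).sub_right (hG.vertex_comm hjk.symm)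
    have hkj' : Commute (G j) (1 - N k) := (Commute.one_right _).sub_right (hG.vertex_comm hjk)
    have hNN : Commute (1 - N j) (1 - N k) :=
      ((Commute.one_right _).sub_right
        ((Commute.one_left _).sub_left (h.vertex_comm j k)))
    have hGk : (1 - N k) * G k = G k * (1 + N k) := by
      rw [sub_mul, hG.vertex_anticomm]
      noncomm_ring
    have hGj : Commute (G j) (1 + N k) := (Commute.one_right _).add_right (hG.vertex_comm hjk)
    have hNN' : Commute (1 - N j) (1 + N k) :=
      ((Commute.one_right _).add_right
        ((Commute.one_left _).sub_left (h.vertex_comm j k)))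
    have e1 : G j * (1 - N j) * ((1 - N k) * G k) = G j * G k * ((1 - N j) * (1 + N k)) := by
      rw [hGk, mul_assoc, ← mul_assoc (1 - N j), ← hjk'.eq]
      simp only [mul_assoc]
    have e2 : (1 - N k) * G k * (G j * (1 - N j)) = G k * G j * ((1 - N j) * (1 + N k)) := by
      rw [hGk, mul_assoc, ← mul_assoc (1 + N k), ← hGj.eq, hNN'.eq]
      simp only [mul_assoc]
    rw [e1, e2, h1, if_neg hjk]
    simp

end IsMajoranaFamily

end Relations

/-! ### Flat connections on the square lattice -/

section Potential

/-- A flat connection on a rectangle of the square lattice has a potential. -/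
lemma exists_potential {Γ : Type*} [Group Γ] (p q : ℕ) (h v : ℕ → ℕ → Γ)
    (hflat : ∀ x y, x + 1 < p → y + 1 < q → h x y * v (x + 1) y = v x y * h x (y + 1)) :
    ∃ G : ℕ → ℕ → Γ, (∀ x y, x + 1 < p → y < q → G (x + 1) y = G x y * h x y) ∧
      ∀ x y, G x (y + 1) = G x y * v x y := by
  -- The transport goes along the bottom row and then up the column. The vertical relation thus
  -- holds by definition, and the horizontal one follows row by row from flatness.
  let G₀ : ℕ → Γ := fun x => Nat.rec 1 (fun i g => g * h i 0) x
  let G : ℕ → ℕ → Γ := fun x y => Nat.rec (G₀ x) (fun i g => g * v x i) y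
  have hG : ∀ x y, G x (y + 1) = G x y * v x y := fun x y => rfl
  refine ⟨G, ?_, hG⟩
  intro x y hx hy
  induction y with
  | zero => rfl
  | succ y ih =>
    rw [hG (x + 1), hG x, ih (by omega), mul_assoc, hflat x y hx hy, mul_assoc]

variable {L₁ L₂ : ℕ}

lemma LatticeAdj.symm {u w : Vertex L₁ L₂} (h : LatticeAdj u w) : LatticeAdj w u := by
  unfold LatticeAdj at *
  rcases h with ⟨h, h'⟩ | ⟨h, h'⟩
  · exact Or.inl ⟨h.symm, h'.symm⟩
  · exact Or.inr ⟨h.symm, h'.symm⟩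

lemma LatticeAdj.ne {u w : Vertex L₁ L₂} (h : LatticeAdj u w) : u ≠ w := by
  rintro rfl
  unfold LatticeAdj at h
  omega

/-- The lattice is connected. -/
lemma lattice_induction (c : Vertex L₁ L₂) (P : Vertex L₁ L₂ → Prop) (hc : P c)
    (hstep : ∀ j k, LatticeAdj j k → P j → P k) (j : Vertex L₁ L₂) : P j := by
  have hiff : ∀ j k, LatticeAdj j k → (P j ↔ P k) := fun j k h => ⟨hstep j k h, hstep k j h.symm⟩
  have hx : ∀ (x : ℕ) (hx : x < L₁) (y : Fin L₂), P (⟨x, hx⟩, y) ↔ P (⟨0, by omega⟩, y) := by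
    intro x
    induction x with
    | zero => intro hx y; rfl
    | succ x ih =>
      intro hx y
      rw [← ih (by omega)]
      exact hiff _ _ (Or.inl ⟨rfl, Or.inl rfl⟩)
  have hy : ∀ (y : ℕ) (hy : y < L₂) (x : Fin L₁), P (x, ⟨y, hy⟩) ↔ P (x, ⟨0, by omega⟩) := by
    intro y
    induction y with
    | zero => intro hy x; rfl
    | succ y ih =>
      intro hy x
      rw [← ih (by omega)]
      exact hiff _ _ (Or.inr ⟨rfl, Or.inl rfl⟩)
  have hall : ∀ j : Vertex L₁ L₂, P j ↔
      P (⟨0, Nat.zero_lt_of_lt j.1.2⟩, ⟨0, Nat.zero_lt_of_lt j.2.2⟩) := fun j =>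
    (hx j.1 j.1.2 j.2).trans (hy j.2 j.2.2 _)
  exact (hall j).2 ((hall c).1 hc)

/-- If the product of the edge operators around every face is trivial, the edge operators are
products of Majorana operators, with a prescribed one at a given vertex. -/
lemma exists_majorana_of_faces {R : Type*} [Ring R] [Algebra ℂ R]
    {E : Vertex L₁ L₂ → Vertex L₁ L₂ → R}
    (hsq : ∀ {j k}, LatticeAdj j k → E j k * E j k = 1)
    (hswap : ∀ {j k}, LatticeAdj j k → E k j = -E j k)
    (hface : ∀ f : Face L₁ L₂, E (f.corner 0 0) (f.corner 1 0) * E (f.corner 1 0) (f.corner 1 1) *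
      E (f.corner 1 1) (f.corner 0 1) * E (f.corner 0 1) (f.corner 0 0) = 1)
    (c : Vertex L₁ L₂) (g : Rˣ) :
    ∃ G : Vertex L₁ L₂ → R, G c = g ∧ ∀ {j k}, LatticeAdj j k → G k = Complex.I • (G j * E j k) := by
  classical
  -- The transport along an edge is right multiplication by `i E j k`. It is a unit, with inverse
  -- the transport back along the edge, so group-valued connections apply.
  have hinv : ∀ {j k}, LatticeAdj j k → (Complex.I • E j k) * (Complex.I • E k j) = 1 := by
    intro j k hjk
    rw [smul_mul_smul_comm, hswap hjk, mul_neg, hsq hjk]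
    simp
  let U : Vertex L₁ L₂ → Vertex L₁ L₂ → Rˣ := fun j k =>
    if hjk : LatticeAdj j k then
      ⟨Complex.I • E j k, Complex.I • E k j, hinv hjk, hinv hjk.symm⟩ else 1
  have hU : ∀ {j k}, LatticeAdj j k → (U j k : R) = Complex.I • E j k := by
    intro j k hjk
    simp [U, hjk]
  have hUU : ∀ {j k}, LatticeAdj j k → U j k * U k j = 1 := by
    intro j k hjk
    ext
    rw [Units.val_mul, hU hjk, hU hjk.symm, hinv hjk, Units.val_one]
  let h : ℕ → ℕ → Rˣ := fun x y => if hxy : x + 1 < L₁ ∧ y < L₂ then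
    U (⟨x, by omega⟩, ⟨y, hxy.2⟩) (⟨x + 1, hxy.1⟩, ⟨y, hxy.2⟩) else 1
  let v : ℕ → ℕ → Rˣ := fun x y => if hxy : x < L₁ ∧ y + 1 < L₂ then
    U (⟨x, hxy.1⟩, ⟨y, by omega⟩) (⟨x, hxy.1⟩, ⟨y + 1, hxy.2⟩) else 1
  obtain ⟨G, hGh, hGv⟩ := exists_potential L₁ L₂ h v (by
    intro x y hx hy
    let f : Face L₁ L₂ := (⟨x, by omega⟩, ⟨y, by omega⟩)
    have a1 : LatticeAdj (f.corner 0 0) (f.corner 1 0) := Or.inl ⟨rfl, Or.inr rfl⟩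
    have a2 : LatticeAdj (f.corner 1 0) (f.corner 1 1) := Or.inr ⟨rfl, Or.inr rfl⟩
    have a3 : LatticeAdj (f.corner 1 1) (f.corner 0 1) := Or.inl ⟨rfl, Or.inl rfl⟩
    have a4 : LatticeAdj (f.corner 0 1) (f.corner 0 0) := Or.inr ⟨rfl, Or.inl rfl⟩
    have key : U (f.corner 0 0) (f.corner 1 0) * U (f.corner 1 0) (f.corner 1 1) *
        U (f.corner 1 1) (f.corner 0 1) * U (f.corner 0 1) (f.corner 0 0) = 1 := by
      ext
      simp only [Units.val_mul, hU a1, hU a2, hU a3, hU a4, smul_mul_smul_comm, hface f,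
        Units.val_one]
      simp
    have e1 : h x y = U (f.corner 0 0) (f.corner 1 0) := dif_pos ⟨hx, by omega⟩
    have e2 : v (x + 1) y = U (f.corner 1 0) (f.corner 1 1) := dif_pos ⟨hx, hy⟩
    have e3 : v x y = U (f.corner 0 0) (f.corner 0 1) := dif_pos ⟨by omega, hy⟩
    have e4 : h x (y + 1) = U (f.corner 0 1) (f.corner 1 1) := dif_pos ⟨hx, hy⟩
    rw [e1, e2, e3, e4]
    have k3 : U (f.corner 0 1) (f.corner 1 1) = (U (f.corner 1 1) (f.corner 0 1))⁻¹ :=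
      eq_inv_of_mul_eq_one_right (hUU a3)
    have k4 : U (f.corner 0 0) (f.corner 0 1) = (U (f.corner 0 1) (f.corner 0 0))⁻¹ :=
      eq_inv_of_mul_eq_one_right (hUU a4)
    rw [k3, k4, ← mul_inv_rev]
    rw [mul_assoc] at key
    exact eq_inv_of_mul_eq_one_left key)
  -- Transport acts on the right, so a constant factor on the left is free; it is chosen to give the
  -- value `g` at `c`.
  let G' : Vertex L₁ L₂ → Rˣ := fun j => g * (G c.1 c.2)⁻¹ * G j.1 j.2
  have hfwd : ∀ {j k}, LatticeAdj j k → G' k = G' j * U j k → G' j = G' k * U k j := by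
    intro j k hjk hG
    rw [hG, mul_assoc, hUU hjk, mul_one]
  have hG' : ∀ {j k}, LatticeAdj j k → G' k = G' j * U j k := by
    rintro ⟨⟨x, hx⟩, ⟨y, hy⟩⟩ ⟨⟨x', hx'⟩, ⟨y', hy'⟩⟩ hjk
    rcases id hjk with ⟨h1, h2 | h2⟩ | ⟨h1, h2 | h2⟩ <;>
      simp only [Fin.mk.injEq] at h1 h2 <;> subst h1 h2
    · refine hfwd hjk.symm ?_
      have := hGh x' y hx hy
      rw [show h x' y = _ from dif_pos ⟨hx, hy⟩] at this
      change _ * _ = _ * _ * _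
      rw [this, ← mul_assoc]
    · have := hGh x y hx' hy
      rw [show h x y = _ from dif_pos ⟨hx', hy⟩] at this
      change _ * _ = _ * _ * _
      rw [this, ← mul_assoc]
    · refine hfwd hjk.symm ?_
      have := hGv x y'
      rw [show v x y' = _ from dif_pos ⟨hx, hy⟩] at this
      change _ * _ = _ * _ * _
      rw [this, ← mul_assoc]
    · have := hGv x y
      rw [show v x y = _ from dif_pos ⟨hx, hy'⟩] at this
      change _ * _ = _ * _ * _
      rw [this, ← mul_assoc]
  refine ⟨fun j => (G' j : R), ?_, ?_⟩
  · simp [G']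
  · intro j k hjk
    change (G' k : R) = Complex.I • ((G' j : R) * E j k)
    rw [hG' hjk, Units.val_mul, hU hjk, mul_smul_comm]

end Potential

end CompactEncoding
end
noncomputable section
namespace CompactEncoding

/-! ### Commutation up to a scalar -/

section SComm

variable {R : Type*} [Ring R] [Algebra ℂ R]

/-- `x` and `y` commute up to the scalar `s`. -/
def SComm (s : ℂ) (x y : R) : Prop := x * y = s • (y * x)

lemma SComm.mul_left {s t : ℂ} {x y z : R} (hx : SComm s x z) (hy : SComm t y z) :
    SComm (s * t) (x * y) z := by
  unfold SComm at *
  rw [mul_assoc, hy, mul_smul_comm, ← mul_assoc, hx, smul_mul_assoc, smul_smul, mul_assoc,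
    mul_comm t s]

lemma SComm.mul_right {s t : ℂ} {x y z : R} (hy : SComm s x y) (hz : SComm t x z) :
    SComm (s * t) x (y * z) := by
  unfold SComm at *
  rw [← mul_assoc, hy, smul_mul_assoc, mul_assoc, hz, mul_smul_comm, smul_smul, ← mul_assoc]

lemma SComm.smul_left {s : ℂ} {x y : R} (h : SComm s x y) (c : ℂ) : SComm s (c • x) y := by
  unfold SComm at *
  rw [smul_mul_assoc, h, mul_smul_comm, smul_comm]

lemma SComm.smul_right {s : ℂ} {x y : R} (h : SComm s x y) (c : ℂ) : SComm s x (c • y) := by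
  unfold SComm at *
  rw [mul_smul_comm, h, smul_mul_assoc, smul_comm]

lemma SComm.neg_left {s : ℂ} {x y : R} (h : SComm s x y) : SComm s (-x) y := by
  simpa using h.smul_left (-1)

lemma SComm.neg_right {s : ℂ} {x y : R} (h : SComm s x y) : SComm s x (-y) := by
  simpa using h.smul_right (-1)

lemma SComm.congr {s t : ℂ} {x y : R} (h : SComm s x y) (hst : s = t) : SComm t x y := hst ▸ h

lemma sComm_one {x y : R} : SComm 1 x y ↔ Commute x y := by
  unfold SComm Commute SemiconjBy
  rw [one_smul]

lemma _root_.Commute.sComm {x y : R} (h : Commute x y) : SComm 1 x y := sComm_one.2 h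

omit [Algebra ℂ R] in
/-- The product of the four edge terms around an odd face. -/
lemma face_product {s s' t t' p q : R} (hs : s * s = 1) (hs' : s' * s' = 1) (ht : t * t = 1)
    (ht' : t' * t' = 1) (hp : p * p = 1) (hq : q * q = 1) (hqp : q * p = -(p * q))
    (hts : Commute t s) (hts' : Commute t s') (ht's' : Commute t' s') (hps : Commute p s)
    (hps' : Commute p s') (hpt : Commute p t) (hpt' : Commute p t') (hqs' : Commute q s')
    (hqt : Commute q t) (hqt' : Commute q t') :
    s * t * p * (s * t' * q) * (s' * t' * p) * (s' * t * q) = -1 := by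
  have hl : ∀ {x : R}, x * x = 1 → ∀ z, x * (x * z) = z := fun hx z => by
    rw [← mul_assoc, hx, one_mul]
  simp only [mul_assoc, hps.left_comm, hps'.left_comm, hpt.left_comm, hpt'.left_comm,
    hqs'.left_comm, hqt.left_comm, hqt'.left_comm, hts.left_comm, hts'.left_comm, ht's'.left_comm,
    hl hs, hl hs', hl ht, hl ht']
  -- All vertex factors have cancelled in pairs. What remains is `p q p q`, which is `-1` because
  -- `p` and `q` are anticommuting involutions.
  rw [← mul_assoc q p q, hqp, neg_mul, mul_assoc, hq, mul_one, mul_neg, hp]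

end SComm

/-! ### Pauli operators at a site -/

section Site

variable {Q : Type*} [Fintype Q] [DecidableEq Q]

lemma siteOp_apply (q : Q) (M : Matrix (Fin 2) (Fin 2) ℂ) (ψ : QubitSpace Q) (s : Q → Fin 2) :
    siteOp q M ψ s = ∑ i, M (s q) i * ψ (Function.update s q i) := by
  have h : siteOp q M ψ s =
      ∑ t, (if ∀ r, r ≠ q → s r = t r then M (s q) (t q) else 0) * ψ t := rfl
  rw [h]
  symm
  apply Finset.sum_of_injOn (fun i => Function.update s q i)
  · intro i _ j _ hij
    simpa using congrFun hij q
  · intro i _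
    simp
  · intro t _ ht
    rw [if_neg, zero_mul]
    intro hr
    apply ht
    refine ⟨t q, by simp, ?_⟩
    funext r
    rcases eq_or_ne r q with rfl | hrq
    · simp
    · simp [hrq, hr r hrq]
  · intro i _
    rw [if_pos]
    · simp
    · intro r hr
      simp [hr]

lemma siteOp_mul (q : Q) (M N : Matrix (Fin 2) (Fin 2) ℂ) :
    siteOp q M * siteOp q N = siteOp q (M * N) := by
  ext ψ s
  rw [mul_apply_eq_comp, siteOp_apply, siteOp_apply]
  simp only [siteOp_apply, Function.update_self, Function.update_idem, Finset.mul_sum,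
    Matrix.mul_apply, Finset.sum_mul]
  rw [Finset.sum_comm]
  simp only [mul_assoc]

lemma siteOp_one (q : Q) : siteOp q 1 = 1 := by
  ext ψ s
  rw [siteOp_apply]
  simp [Matrix.one_apply]

lemma siteOp_neg (q : Q) (M : Matrix (Fin 2) (Fin 2) ℂ) : siteOp q (-M) = -siteOp q M := by
  ext ψ s
  simp [siteOp_apply]

lemma siteOp_commute {q r : Q} (hqr : q ≠ r) (M N : Matrix (Fin 2) (Fin 2) ℂ) :
    Commute (siteOp q M) (siteOp r N) := by
  ext ψ s
  rw [mul_apply_eq_comp, mul_apply_eq_comp, siteOp_apply, siteOp_apply]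
  simp only [siteOp_apply, Function.update_of_ne hqr, Function.update_of_ne hqr.symm,
    Finset.mul_sum]
  rw [Finset.sum_comm]
  refine Finset.sum_congr rfl fun i _ => Finset.sum_congr rfl fun j _ => ?_
  rw [Function.update_comm hqr]
  ring

lemma star_siteOp (q : Q) (M : Matrix (Fin 2) (Fin 2) ℂ) :
    star (siteOp q M) = siteOp q M.conjTranspose := by
  unfold siteOp
  rw [← map_star, Matrix.star_eq_conjTranspose]
  congr 1
  ext s t
  simp only [Matrix.conjTranspose_apply, Matrix.of_apply]
  by_cases h : ∀ r, r ≠ q → s r = t r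
  · rw [if_pos h, if_pos fun r hr => (h r hr).symm]
  · rw [if_neg h, if_neg fun h' => h fun r hr => (h' r hr).symm, star_zero]

lemma siteOp_anticomm (q : Q) {M N : Matrix (Fin 2) (Fin 2) ℂ} (h : M * N = -(N * M)) :
    SComm (-1) (siteOp q M) (siteOp q N) := by
  unfold SComm
  rw [siteOp_mul, siteOp_mul, h, siteOp_neg]
  simp

@[simp] lemma pauliX_sq : pauliX * pauliX = 1 := by
  ext i j
  fin_cases i <;> fin_cases j <;> simp [pauliX]

@[simp] lemma pauliY_sq : pauliY * pauliY = 1 := by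
  ext i j
  fin_cases i <;> fin_cases j <;> simp [pauliY]

@[simp] lemma pauliZ_sq : pauliZ * pauliZ = 1 := by
  ext i j
  fin_cases i <;> fin_cases j <;> simp [pauliZ]

lemma pauliX_mul_pauliY : pauliX * pauliY = -(pauliY * pauliX) := by
  ext i j
  fin_cases i <;> fin_cases j <;> simp [pauliX, pauliY]

lemma pauliY_mul_pauliX : pauliY * pauliX = -(pauliX * pauliY) := by
  rw [pauliX_mul_pauliY, neg_neg]

lemma pauliX_mul_pauliZ : pauliX * pauliZ = -(pauliZ * pauliX) := by
  ext i j
  fin_cases i <;> fin_cases j <;> simp [pauliX, pauliZ]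

lemma pauliY_mul_pauliZ : pauliY * pauliZ = -(pauliZ * pauliY) := by
  ext i j
  fin_cases i <;> fin_cases j <;> simp [pauliY, pauliZ]

lemma pauliZ_mul_pauliX : pauliZ * pauliX = -(pauliX * pauliZ) := by
  rw [pauliX_mul_pauliZ, neg_neg]

lemma pauliZ_mul_pauliY : pauliZ * pauliY = -(pauliY * pauliZ) := by
  rw [pauliY_mul_pauliZ, neg_neg]

@[simp] lemma pauliX_conjTranspose : pauliX.conjTranspose = pauliX := by
  ext i j
  fin_cases i <;> fin_cases j <;> simp [pauliX]

@[simp] lemma pauliY_conjTranspose : pauliY.conjTranspose = pauliY := by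
  ext i j
  fin_cases i <;> fin_cases j <;> simp [pauliY]

@[simp] lemma pauliZ_conjTranspose : pauliZ.conjTranspose = pauliZ := by
  ext i j
  fin_cases i <;> fin_cases j <;> simp [pauliZ]

end Site

/-! ### Arrows and odd faces -/

section Arrows

variable {L₁ L₂ a b : ℕ}

lemma Arrow.latticeAdj {u w : Vertex L₁ L₂} (h : Arrow a b u w) : LatticeAdj u w := by
  unfold Arrow at h
  unfold LatticeAdj
  split_ifs at h <;> omega

lemma Arrow.asymm {u w : Vertex L₁ L₂} (h : Arrow a b u w) : ¬ Arrow a b w u := by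
  unfold Arrow at *
  simp only [Fin.ext_iff, Nat.even_iff] at *
  split_ifs at h ⊢ <;> omega

lemma LatticeAdj.arrow_or {u w : Vertex L₁ L₂} (h : LatticeAdj u w) :
    Arrow a b u w ∨ Arrow a b w u := by
  rcases h with ⟨h, h' | h'⟩ | ⟨h, h' | h'⟩
  · by_cases p : Even ((u.2 : ℕ) + b)
    · exact Or.inl (Or.inl ⟨h, by rwa [if_pos p]⟩)
    · exact Or.inr (Or.inl ⟨h.symm, by rwa [← h, if_neg p]⟩)
  · by_cases p : Even ((u.2 : ℕ) + b)
    · exact Or.inr (Or.inl ⟨h.symm, by rwa [← h, if_pos p]⟩)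
    · exact Or.inl (Or.inl ⟨h, by rwa [if_neg p]⟩)
  · by_cases p : Even ((u.1 : ℕ) + a)
    · exact Or.inl (Or.inr ⟨h, by rwa [if_pos p]⟩)
    · exact Or.inr (Or.inr ⟨h.symm, by rwa [← h, if_neg p]⟩)
  · by_cases p : Even ((u.1 : ℕ) + a)
    · exact Or.inr (Or.inr ⟨h.symm, by rwa [← h, if_pos p]⟩)
    · exact Or.inl (Or.inr ⟨h, by rwa [if_neg p]⟩)

lemma Arrow.horizontal {u w : Vertex L₁ L₂} (h : Arrow a b u w) (hu : u.2 = w.2) :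
    (((u.2 : ℕ) + b) % 2 = 0 ∧ (u.1 : ℕ) = w.1 + 1) ∨
      (((u.2 : ℕ) + b) % 2 = 1 ∧ (w.1 : ℕ) = u.1 + 1) := by
  unfold Arrow at h
  simp only [Fin.ext_iff, Nat.even_iff] at *
  split_ifs at h <;> omega

lemma Arrow.vertical {u w : Vertex L₁ L₂} (h : Arrow a b u w) (hu : u.2 ≠ w.2) :
    u.1 = w.1 ∧ ((((u.1 : ℕ) + a) % 2 = 0 ∧ (u.2 : ℕ) = w.2 + 1) ∨
      (((u.1 : ℕ) + a) % 2 = 1 ∧ (w.2 : ℕ) = u.2 + 1)) := by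
  unfold Arrow at h
  simp only [ne_eq, Fin.ext_iff, Nat.even_iff] at *
  split_ifs at h <;> omega

/-- Arrows in one row, or in one column, all point the same way, so distinct ones can meet only head
to tail. -/
lemma Arrow.eq_iff_of_parallel {u w u' w' : Vertex L₁ L₂} (h : Arrow a b u w)
    (h' : Arrow a b u' w') (hp : u.2 = w.2 ↔ u'.2 = w'.2) : u = u' ↔ w = w' := by
  by_cases hu : u.2 = w.2
  · have h1 := h.horizontal hu
    have h2 := h'.horizontal (hp.1 hu)
    have hu' := hp.1 hu
    clear h h' hp
    simp only [Prod.ext_iff, Fin.ext_iff] at *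
    rcases h1 with h1 | h1 <;> rcases h2 with h2 | h2 <;> omega
  · have h1 := h.vertical hu
    have h2 := h'.vertical (fun h => hu (hp.2 h))
    clear h h' hp hu
    simp only [Prod.ext_iff, Fin.ext_iff] at *
    obtain ⟨h1', h1⟩ := h1
    obtain ⟨h2', h2⟩ := h2
    rcases h1 with h1 | h1 <;> rcases h2 with h2 | h2 <;> omega

/-- Perpendicular edges of a face meet in exactly one vertex, and at a vertex of an odd face its two
edges both point out or both point in. Hence exactly one of the two coincidences, of tails or of
heads, occurs. -/
lemma Arrow.eq_iff_of_face {u w u' w' : Vertex L₁ L₂} (h : Arrow a b u w)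
    (h' : Arrow a b u' w') (hu : u.2 = w.2) (hu' : u'.2 ≠ w'.2) {f : Face L₁ L₂}
    (hf : IsOddFace a b f) (fu : f.HasVertex u) (fw : f.HasVertex w) (fu' : f.HasVertex u')
    (fw' : f.HasVertex w') : u = u' ↔ w ≠ w' := by
  have h1 := h.horizontal hu
  obtain ⟨h2, h3⟩ := h'.vertical hu'
  clear h h' hu'
  obtain ⟨fu1, fu2⟩ := fu
  obtain ⟨fw1, -⟩ := fw
  obtain ⟨fu1', fu2'⟩ := fu'
  obtain ⟨-, fw2'⟩ := fw'
  obtain ⟨⟨f1, hf1⟩, ⟨f2, hf2⟩⟩ := f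
  obtain ⟨⟨u1, hu1⟩, ⟨u2, hu2⟩⟩ := u
  obtain ⟨⟨w1, hw1⟩, ⟨w2, hw2⟩⟩ := w
  obtain ⟨⟨u1', hu1'⟩, ⟨u2', hu2'⟩⟩ := u'
  obtain ⟨⟨w1', hw1'⟩, ⟨w2', hw2'⟩⟩ := w'
  unfold IsOddFace at hf
  simp only [ne_eq, Prod.mk.injEq, Fin.mk.injEq, Nat.even_iff] at *
  clear hf1 hf2 hu1 hu2 hw1 hw2 hu1' hu2' hw1' hw2'
  subst hu h2
  rcases h1 with ⟨h1, rfl⟩ | ⟨h1, rfl⟩ <;> rcases h3 with ⟨h3, rfl⟩ | ⟨h3, rfl⟩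
  · have e1 : f1 = w1 := by omega
    have e2 : f2 = w2' := by omega
    subst e1 e2
    omega
  · have e1 : f1 = w1 := by omega
    have e2 : f2 = u2' := by omega
    subst e1 e2
    omega
  · have e1 : f1 = u1 := by omega
    have e2 : f2 = w2' := by omega
    subst e1 e2
    omega
  · have e1 : f1 = u1 := by omega
    have e2 : f2 = u2' := by omega
    subst e1 e2
    omega

/-- Perpendicular edges with a common vertex span a face. It cannot be even, since around an even
face the arrows circulate and meet head to tail. -/
lemma Arrow.exists_face {u w u' w' : Vertex L₁ L₂} (h : Arrow a b u w)
    (h' : Arrow a b u' w') (hu : u.2 = w.2) (hu' : u'.2 ≠ w'.2) (he : u = u' ∨ w = w') :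
    ∃ f : Face L₁ L₂, IsOddFace a b f ∧ f.HasVertex u ∧ f.HasVertex w ∧ f.HasVertex u' ∧
      f.HasVertex w' := by
  have h1 := h.horizontal hu
  obtain ⟨h2, h3⟩ := h'.vertical hu'
  clear h h' hu'
  obtain ⟨⟨u1, hu1⟩, ⟨u2, hu2⟩⟩ := u
  obtain ⟨⟨w1, hw1⟩, ⟨w2, hw2⟩⟩ := w
  obtain ⟨⟨u1', hu1'⟩, ⟨u2', hu2'⟩⟩ := u'
  obtain ⟨⟨w1', hw1'⟩, ⟨w2', hw2'⟩⟩ := w'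
  unfold Face.HasVertex IsOddFace
  simp only [Prod.mk.injEq, Fin.mk.injEq, Nat.even_iff] at *
  subst hu h2
  rcases h1 with ⟨h1, rfl⟩ | ⟨h1, rfl⟩ <;> rcases h3 with ⟨h3, rfl⟩ | ⟨h3, rfl⟩
  -- In each case the lower left vertex combines the smaller column of the horizontal arrow with the
  -- smaller row of the vertical one.
  · exact ⟨(⟨w1, by omega⟩, ⟨w2', by omega⟩), by dsimp only; omega⟩
  · exact ⟨(⟨w1, by omega⟩, ⟨u2', by omega⟩), by dsimp only; omega⟩
  · exact ⟨(⟨u1, by omega⟩, ⟨w2', by omega⟩), by dsimp only; omega⟩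
  · exact ⟨(⟨u1, by omega⟩, ⟨u2', by omega⟩), by dsimp only; omega⟩

/-- Two faces that share an edge have opposite labels in the checkerboard. This makes the choice in
`faceSite` harmless. -/
lemma oddFace_unique {u w : Vertex L₁ L₂} (h : LatticeAdj u w) {f f' : Face L₁ L₂}
    (hf : IsOddFace a b f) (hf' : IsOddFace a b f') (fu : f.HasVertex u) (fw : f.HasVertex w)
    (fu' : f'.HasVertex u) (fw' : f'.HasVertex w) : f = f' := by
  obtain ⟨fu1, fu2⟩ := fu
  obtain ⟨fw1, fw2⟩ := fw
  obtain ⟨fu1', fu2'⟩ := fu'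
  obtain ⟨fw1', fw2'⟩ := fw'
  unfold IsOddFace at hf hf'
  simp only [Prod.ext_iff, Fin.ext_iff, Nat.even_iff] at *
  rcases h with ⟨h, h' | h'⟩ | ⟨h, h' | h'⟩ <;> simp only [Fin.ext_iff] at h
  · have e1 : (f.1 : ℕ) = w.1 := by omega
    have e2 : (f'.1 : ℕ) = w.1 := by omega
    clear fu1 fw1 fu1' fw1'
    omega
  · have e1 : (f.1 : ℕ) = u.1 := by omega
    have e2 : (f'.1 : ℕ) = u.1 := by omega
    clear fu1 fw1 fu1' fw1'
    omega
  · have e1 : (f.2 : ℕ) = w.2 := by omega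
    have e2 : (f'.2 : ℕ) = w.2 := by omega
    clear fu2 fw2 fu2' fw2'
    omega
  · have e1 : (f.2 : ℕ) = u.2 := by omega
    have e2 : (f'.2 : ℕ) = u.2 := by omega
    clear fu2 fw2 fu2' fw2'
    omega

end Arrows

end CompactEncoding
end
noncomputable section
namespace CompactEncoding

/-! ### The relations of the encoded operators -/

section EncodedRelations

variable {L₁ L₂ a b : ℕ}

lemma SComm.symm {R : Type*} [Ring R] [Algebra ℂ R] {s : ℂ} {x y : R} (h : SComm s x y)
    (hs : s * s = 1) : SComm s y x := by
  unfold SComm at *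
  rw [h, smul_smul, hs, one_smul]

/-- The Pauli matrix of an edge on the adjacent odd face. -/
def edgePauli (u w : Vertex L₁ L₂) : Matrix (Fin 2) (Fin 2) ℂ :=
  if u.2 = w.2 then pauliY else pauliX

/-- The sign of the encoded operator of an edge. -/
def edgeSign (u w : Vertex L₁ L₂) : ℂ := if u.2 = w.2 ∨ w.2 < u.2 then 1 else -1

lemma edgePauli_sq (u w : Vertex L₁ L₂) : edgePauli u w * edgePauli u w = 1 := by
  unfold edgePauli
  split_ifs <;> simp

lemma edgePauli_conjTranspose (u w : Vertex L₁ L₂) :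
    (edgePauli u w).conjTranspose = edgePauli u w := by
  unfold edgePauli
  split_ifs <;> simp

lemma arrowOp_eq (u w : Vertex L₁ L₂) :
    arrowOp a b u w = edgeSign u w •
      (vertexSite a b u pauliX * vertexSite a b w pauliY * faceSite a b u w (edgePauli u w)) := by
  unfold arrowOp edgeSign edgePauli
  by_cases h1 : u.2 = w.2
  · simp [h1]
  · by_cases h2 : w.2 < u.2
    · simp [h1, h2]
    · simp only [h1, h2, if_false, or_self]
      exact (neg_one_smul ℂ _).symm

lemma faceSite_cases (a b : ℕ) (u w : Vertex L₁ L₂) :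
    (∃ f : {f : Face L₁ L₂ // IsOddFace a b f}, f.1.HasVertex u ∧ f.1.HasVertex w ∧
      ∀ M, faceSite a b u w M = siteOp (Sum.inr f) M) ∨ ∀ M, faceSite a b u w M = 1 := by
  by_cases h : ∃ f : {f : Face L₁ L₂ // IsOddFace a b f}, f.1.HasVertex u ∧ f.1.HasVertex w
  · exact Or.inl ⟨h.choose, h.choose_spec.1, h.choose_spec.2, fun M => dif_pos h⟩
  · exact Or.inr fun M => dif_neg h

lemma faceSite_of_hasVertex {u w : Vertex L₁ L₂} (h : LatticeAdj u w)
    (f : {f : Face L₁ L₂ // IsOddFace a b f}) (fu : f.1.HasVertex u) (fw : f.1.HasVertex w)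
    (M : Matrix (Fin 2) (Fin 2) ℂ) : faceSite a b u w M = siteOp (Sum.inr f) M := by
  have hex : ∃ f : {f : Face L₁ L₂ // IsOddFace a b f}, f.1.HasVertex u ∧ f.1.HasVertex w :=
    ⟨f, fu, fw⟩
  have hf : hex.choose = f := Subtype.ext
    (oddFace_unique h hex.choose.2 f.2 hex.choose_spec.1 hex.choose_spec.2 fu fw)
  unfold faceSite
  rw [dif_pos hex, hf]

lemma vertexSite_commute_faceSite (v u w : Vertex L₁ L₂) (M N : Matrix (Fin 2) (Fin 2) ℂ) :
    Commute (vertexSite a b v M) (faceSite a b u w N) := by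
  rcases faceSite_cases a b u w with ⟨f, -, -, hf⟩ | hf
  · rw [hf]
    exact siteOp_commute (by simp) M N
  · rw [hf]
    exact Commute.one_right _

lemma vertexSite_commute (u w : Vertex L₁ L₂) (M : Matrix (Fin 2) (Fin 2) ℂ) :
    Commute (vertexSite a b u M) (vertexSite a b w M) := by
  rcases eq_or_ne u w with rfl | h
  · exact Commute.refl _
  · exact siteOp_commute (by simpa using h) M M

lemma vertexSite_commute_of_ne {u w : Vertex L₁ L₂} (h : u ≠ w)
    (M N : Matrix (Fin 2) (Fin 2) ℂ) : Commute (vertexSite a b u M) (vertexSite a b w N) :=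
  siteOp_commute (by simpa using h) M N

lemma vertexSite_sComm (u w : Vertex L₁ L₂) {M N : Matrix (Fin 2) (Fin 2) ℂ}
    (h : M * N = -(N * M)) : SComm (chi u w) (vertexSite a b u M) (vertexSite a b w N) := by
  rcases eq_or_ne u w with rfl | hne
  · rw [chi_self]
    exact siteOp_anticomm _ h
  · rw [chi_of_ne hne]
    exact (vertexSite_commute_of_ne hne M N).sComm

lemma vertexSite_sq (u : Vertex L₁ L₂) {M : Matrix (Fin 2) (Fin 2) ℂ} (h : M * M = 1) :
    vertexSite a b u M * vertexSite a b u M = 1 := by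
  unfold vertexSite
  rw [siteOp_mul, h, siteOp_one]

lemma star_vertexSite (u : Vertex L₁ L₂) {M : Matrix (Fin 2) (Fin 2) ℂ}
    (h : M.conjTranspose = M) : star (vertexSite a b u M) = vertexSite a b u M := by
  unfold vertexSite
  rw [star_siteOp, h]

lemma faceSite_sq (u w : Vertex L₁ L₂) {M : Matrix (Fin 2) (Fin 2) ℂ} (h : M * M = 1) :
    faceSite a b u w M * faceSite a b u w M = 1 := by
  rcases faceSite_cases a b u w with ⟨f, -, -, hf⟩ | hf
  · rw [hf, siteOp_mul, h, siteOp_one]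
  · rw [hf, mul_one]

lemma star_faceSite (u w : Vertex L₁ L₂) {M : Matrix (Fin 2) (Fin 2) ℂ}
    (h : M.conjTranspose = M) : star (faceSite a b u w M) = faceSite a b u w M := by
  rcases faceSite_cases a b u w with ⟨f, -, -, hf⟩ | hf
  · rw [hf, star_siteOp, h]
  · rw [hf, star_one]

lemma chi_mul_chi_of_iff {u u' w w' : Vertex L₁ L₂} (h : u = u' ↔ w = w') :
    chi u u' * chi w w' = 1 := by
  by_cases hu : u = u'
  · simp [chi, hu, h.1 hu]
  · rw [chi_of_ne hu, chi_of_ne fun hw => hu (h.2 hw), mul_one]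

lemma chi_mul_chi_of_iff_ne {u u' w w' : Vertex L₁ L₂} (h : u = u' ↔ w ≠ w') :
    chi u u' * chi w w' = -1 := by
  by_cases hu : u = u'
  · rw [chi_of_ne (h.1 hu)]
    simp [hu]
  · have hw : w = w' := by
      by_contra hw
      exact hu (h.2 hw)
    rw [chi_of_ne hu]
    simp [hw]

/-- Here the face qubits do their work. At a common tail both arrows carry `X`, at a common head
both carry `Y`, so the vertex Paulis commute there although fermionic edges with one common vertex
anticommute. The missing sign comes from `Y` against `X` on the common odd face. Without a common
tail or head the arrows have no odd face in common, and no sign arises. -/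
lemma faceSite_sComm_of_perpendicular {u w u' w' : Vertex L₁ L₂} (h : Arrow a b u w)
    (h' : Arrow a b u' w') (hu : u.2 = w.2) (hu' : u'.2 ≠ w'.2) :
    SComm (chi u u' * chi w w') (faceSite a b u w pauliY) (faceSite a b u' w' pauliX) := by
  by_cases he : u = u' ∨ w = w'
  · obtain ⟨f, hf, fu, fw, fu', fw'⟩ := h.exists_face h' hu hu' he
    rw [faceSite_of_hasVertex h.latticeAdj ⟨f, hf⟩ fu fw,
      faceSite_of_hasVertex h'.latticeAdj ⟨f, hf⟩ fu' fw',
      chi_mul_chi_of_iff_ne (h.eq_iff_of_face h' hu hu' hf fu fw fu' fw')]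
    exact siteOp_anticomm _ pauliY_mul_pauliX
  · rw [not_or] at he
    rw [chi_of_ne he.1, chi_of_ne he.2, mul_one]
    apply Commute.sComm
    rcases faceSite_cases a b u w with ⟨f, fu, fw, hf⟩ | hf
    · rcases faceSite_cases a b u' w' with ⟨f', fu', fw', hf'⟩ | hf'
      · rw [hf, hf']
        refine siteOp_commute ?_ _ _
        intro hff
        obtain rfl := Sum.inr_injective hff
        exact he.1 ((h.eq_iff_of_face h' hu hu' f.2 fu fw fu' fw').2 he.2)
      · rw [hf']
        exact Commute.one_right _
    · rw [hf]
      exact Commute.one_left _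

lemma faceSite_sComm {u w u' w' : Vertex L₁ L₂} (h : Arrow a b u w) (h' : Arrow a b u' w') :
    SComm (chi u u' * chi w w') (faceSite a b u w (edgePauli u w))
      (faceSite a b u' w' (edgePauli u' w')) := by
  by_cases hp : u.2 = w.2 ↔ u'.2 = w'.2
  · rw [chi_mul_chi_of_iff (h.eq_iff_of_parallel h' hp)]
    have hM : edgePauli u w = edgePauli u' w' := by
      unfold edgePauli
      simp only [hp]
    rw [hM]
    apply Commute.sComm
    rcases faceSite_cases a b u w with ⟨f, fu, fw, hf⟩ | hf
    · rcases faceSite_cases a b u' w' with ⟨f', fu', fw', hf'⟩ | hf'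
      · rw [hf, hf']
        rcases eq_or_ne f f' with rfl | hne
        · exact Commute.refl _
        · exact siteOp_commute (by simpa using hne) _ _
      · rw [hf']
        exact Commute.one_right _
    · rw [hf]
      exact Commute.one_left _
  · by_cases hu : u.2 = w.2
    · have hu' : u'.2 ≠ w'.2 := fun h => hp ⟨fun _ => h, fun _ => hu⟩
      have := faceSite_sComm_of_perpendicular h h' hu hu'
      simpa [edgePauli, hu, hu'] using this
    · have hu' : u'.2 = w'.2 := by
        by_contra h
        exact hp ⟨fun h' => absurd h' hu, fun h' => absurd h' h⟩
      have := (faceSite_sComm_of_perpendicular h' h hu' hu).symm (by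
        linear_combination (chi w' w * chi w' w) * chi_mul_self u' u + chi_mul_self w' w)
      rw [chi_comm u u', chi_comm w w']
      simpa [edgePauli, hu, hu'] using this

/-- An arrow carries `X` at its tail and `Y` at its head, so `X_v` detects only heads and, below,
`Y_v` only tails. -/
lemma vertexX_sComm_arrowOp (v u w : Vertex L₁ L₂) :
    SComm (chi v w) (vertexSite a b v pauliX) (arrowOp a b u w) := by
  rw [arrowOp_eq]
  refine (SComm.smul_right (((vertexSite_commute v u pauliX).sComm.mul_right
    (vertexSite_sComm v w pauliX_mul_pauliY)).mul_right
    (vertexSite_commute_faceSite v u w _ _).sComm) _).congr ?_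
  ring

lemma vertexY_sComm_arrowOp (v u w : Vertex L₁ L₂) :
    SComm (chi v u) (vertexSite a b v pauliY) (arrowOp a b u w) := by
  rw [arrowOp_eq]
  refine (SComm.smul_right (((vertexSite_sComm v u pauliY_mul_pauliX).mul_right
    (vertexSite_commute v w pauliY).sComm).mul_right
    (vertexSite_commute_faceSite v u w _ _).sComm) _).congr ?_
  ring

lemma vertexOp_sComm_arrowOp (v u w : Vertex L₁ L₂) :
    SComm (chi v u * chi v w) (vertexOp a b v) (arrowOp a b u w) := by
  rw [arrowOp_eq]
  refine (SComm.smul_right (((vertexSite_sComm v u pauliZ_mul_pauliX).mul_right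
    (vertexSite_sComm v w pauliZ_mul_pauliY)).mul_right
    (vertexSite_commute_faceSite v u w _ _).sComm) _).congr ?_
  ring

/-- The vertex Paulis account for the signs `chi u w'` and `chi w u'` of head meeting tail, and the
face Pauli for `chi u u'` and `chi w w'`. -/
lemma arrowOp_sComm {u w u' w' : Vertex L₁ L₂} (h : Arrow a b u w) (h' : Arrow a b u' w') :
    SComm (chi u u' * chi u w' * (chi w u' * chi w w')) (arrowOp a b u w) (arrowOp a b u' w') := by
  have hF : SComm (chi u u' * chi w w') (faceSite a b u w (edgePauli u w)) (arrowOp a b u' w') := by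
    rw [arrowOp_eq]
    refine (SComm.smul_right (((vertexSite_commute_faceSite u' u w _ _).symm.sComm.mul_right
      (vertexSite_commute_faceSite w' u w _ _).symm.sComm).mul_right
      (faceSite_sComm h h')) _).congr ?_
    ring
  rw [arrowOp_eq u w]
  refine (SComm.smul_left (((vertexX_sComm_arrowOp u u' w').mul_left
    (vertexY_sComm_arrowOp w u' w')).mul_left hF) _).congr ?_
  ring

lemma edgeSign_sq (u w : Vertex L₁ L₂) : edgeSign u w * edgeSign u w = 1 := by
  unfold edgeSign
  split_ifs <;> norm_num

lemma star_edgeSign (u w : Vertex L₁ L₂) : star (edgeSign u w) = edgeSign u w := by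
  unfold edgeSign
  split_ifs <;> simp

lemma star_smul_mul_mul {R : Type*} [Ring R] [StarRing R] [Algebra ℂ R] [StarModule ℂ R]
    {x y z : R} {c : ℂ} (hx : star x = x) (hy : star y = y) (hz : star z = z) (hc : star c = c)
    (hxy : Commute x y) (hxz : Commute x z) (hyz : Commute y z) :
    star (c • (x * y * z)) = c • (x * y * z) := by
  rw [star_smul, star_mul, star_mul, hx, hy, hz, hc, ← hxy.eq, (hxz.mul_left hyz).eq]

lemma star_arrowOp {u w : Vertex L₁ L₂} (h : Arrow a b u w) :
    star (arrowOp a b u w) = arrowOp a b u w := by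
  rw [arrowOp_eq]
  exact star_smul_mul_mul (star_vertexSite _ pauliX_conjTranspose)
    (star_vertexSite _ pauliY_conjTranspose) (star_faceSite _ _ (edgePauli_conjTranspose _ _))
    (star_edgeSign _ _) (vertexSite_commute_of_ne h.latticeAdj.ne _ _)
    (vertexSite_commute_faceSite _ _ _ _ _) (vertexSite_commute_faceSite _ _ _ _ _)

lemma arrowOp_sq {u w : Vertex L₁ L₂} (h : Arrow a b u w) :
    arrowOp a b u w * arrowOp a b u w = 1 := by
  have huw : Commute (vertexSite a b u pauliX) (vertexSite a b w pauliY) :=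
    vertexSite_commute_of_ne h.latticeAdj.ne _ _
  have hF := (vertexSite_commute_faceSite (a := a) (b := b) u u w pauliX (edgePauli u w)).mul_left
    (vertexSite_commute_faceSite w u w pauliY (edgePauli u w))
  rw [arrowOp_eq, smul_mul_smul_comm, edgeSign_sq, one_smul, hF.symm.mul_mul_mul_comm,
    huw.symm.mul_mul_mul_comm, vertexSite_sq _ pauliX_sq, vertexSite_sq _ pauliY_sq,
    faceSite_sq _ _ (edgePauli_sq _ _)]
  simp

lemma edgeOp_of_arrow {u w : Vertex L₁ L₂} (h : Arrow a b u w) :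
    edgeOp a b u w = arrowOp a b u w := by
  unfold edgeOp
  rw [if_pos h]

lemma edgeOp_of_arrow_symm {u w : Vertex L₁ L₂} (h : Arrow a b w u) :
    edgeOp a b u w = -arrowOp a b w u := by
  unfold edgeOp
  rw [if_neg h.asymm, if_pos h]

/-- The encoded edge and vertex operators satisfy the relations of the fermionic ones. -/
lemma isEdgeVertex_encoded (a b : ℕ) :
    IsEdgeVertex (R := QubitOp L₁ L₂ a b) LatticeAdj (edgeOp a b) (vertexOp a b) where
  symm := fun h => h.symm
  ne := fun h => h.ne
  edge_star := by
    intro j k h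
    rcases h.arrow_or (a := a) (b := b) with h | h
    · rw [edgeOp_of_arrow h, star_arrowOp h]
    · rw [edgeOp_of_arrow_symm h, star_neg, star_arrowOp h]
  edge_sq := by
    intro j k h
    rcases h.arrow_or (a := a) (b := b) with h | h
    · rw [edgeOp_of_arrow h, arrowOp_sq h]
    · rw [edgeOp_of_arrow_symm h]
      exact (neg_mul_neg _ _).trans (arrowOp_sq h)
  edge_swap := by
    intro j k h
    rcases h.arrow_or (a := a) (b := b) with h | h
    · rw [edgeOp_of_arrow h, edgeOp_of_arrow_symm h]
    · rw [edgeOp_of_arrow h, edgeOp_of_arrow_symm h, neg_neg]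
  edge_comm := by
    intro j k l m h h'
    change SComm _ _ _
    rcases h.arrow_or (a := a) (b := b) with h | h <;>
      rcases h'.arrow_or (a := a) (b := b) with h' | h'
    · rw [edgeOp_of_arrow h, edgeOp_of_arrow h']
      exact arrowOp_sComm h h'
    · rw [edgeOp_of_arrow h, edgeOp_of_arrow_symm h']
      exact (arrowOp_sComm h h').neg_right.congr (by ring)
    · rw [edgeOp_of_arrow_symm h, edgeOp_of_arrow h']
      exact (arrowOp_sComm h h').neg_left.congr (by ring)
    · rw [edgeOp_of_arrow_symm h, edgeOp_of_arrow_symm h']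
      exact (arrowOp_sComm h h').neg_left.neg_right.congr (by ring)
  vertex_star := fun j => star_vertexSite _ pauliZ_conjTranspose
  vertex_sq := fun j => vertexSite_sq _ pauliZ_sq
  vertex_comm := fun j k => vertexSite_commute j k pauliZ
  vertex_edge := by
    intro l m h j
    change SComm _ _ _
    rcases h.arrow_or (a := a) (b := b) with h | h
    · rw [edgeOp_of_arrow h]
      exact vertexOp_sComm_arrowOp j l m
    · rw [edgeOp_of_arrow_symm h]
      exact (vertexOp_sComm_arrowOp j m l).neg_right.congr (by ring)

/-! ### Odd corners -/

/-- Two collinear edges cannot meet at a corner of the lattice. Two perpendicular ones, one entering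
and one leaving, would span an even face at `c`. -/
lemma IsOddCorner.not_arrow {c u w : Vertex L₁ L₂} (hc : IsOddCorner a b c)
    (h : Arrow a b u c) : ¬ Arrow a b c w := by
  intro h'
  obtain ⟨h1, h2, h3⟩ := hc
  by_cases hu : u.2 = c.2
  · by_cases hw : c.2 = w.2
    · have e1 := h.horizontal hu
      have e2 := h'.horizontal hw
      rw [hu] at e1
      omega
    · have e1 := h.horizontal hu
      obtain ⟨e3, e2⟩ := h'.vertical hw
      have hu1 := u.1.2
      have hc1 := c.1.2
      have hw2 := w.2.2
      have hc2 := c.2.2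
      -- The face spanned by the two edges; its lower left vertex is found by taking minima of the
      -- coordinates.
      have key := h3 (⟨min (u.1 : ℕ) c.1, by omega⟩, ⟨min (w.2 : ℕ) c.2, by omega⟩) (by
        constructor <;> dsimp only <;> omega)
      unfold IsOddFace at key
      simp only [Nat.even_iff, Fin.ext_iff] at *
      rcases e1 with e1 | e1 <;> rcases e2 with e2 | e2 <;> omega
  · obtain ⟨e3, e1⟩ := h.vertical hu
    by_cases hw : c.2 = w.2
    · have e2 := h'.horizontal hw
      have hu1 := w.1.2
      have hc1 := c.1.2
      have hw2 := u.2.2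
      have hc2 := c.2.2
      have key := h3 (⟨min (w.1 : ℕ) c.1, by omega⟩, ⟨min (u.2 : ℕ) c.2, by omega⟩) (by
        constructor <;> dsimp only <;> omega)
      unfold IsOddFace at key
      simp only [Nat.even_iff, Fin.ext_iff] at *
      rcases e1 with e1 | e1 <;> rcases e2 with e2 | e2 <;> omega
    · obtain ⟨e4, e2⟩ := h'.vertical hw
      rw [e3] at e1
      omega

lemma sComm_edgeOp_of_arrowOp {s : Vertex L₁ L₂ → Vertex L₁ L₂ → ℂ} (hs : ∀ u w, s u w = s w u)
    {T : QubitOp L₁ L₂ a b} (hT : ∀ u w, Arrow a b u w → SComm (s u w) T (arrowOp a b u w))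
    {l m : Vertex L₁ L₂} (h : LatticeAdj l m) : SComm (s l m) T (edgeOp a b l m) := by
  rcases h.arrow_or (a := a) (b := b) with h | h
  · rw [edgeOp_of_arrow h]
    exact hT l m h
  · rw [edgeOp_of_arrow_symm h, hs]
    exact (hT m l h).neg_right

/-- `X_c` anticommutes with the arrows that end in `c`, and `Y_c` with those that start there. At an
odd corner only one kind occurs, so one Pauli operator anticommutes with every edge at `c`. -/
lemma isMajorana_cornerMajorana {c : Vertex L₁ L₂} (hc : IsOddCorner a b c) :
    IsMajorana LatticeAdj (edgeOp a b) (vertexOp a b) c (cornerMajorana a b c) := by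
  unfold cornerMajorana
  split_ifs with h
  · obtain ⟨v, hv⟩ := h
    refine ⟨star_vertexSite _ pauliX_conjTranspose, vertexSite_sq _ pauliX_sq, ?_, ?_⟩
    · intro l m hlm
      refine sComm_edgeOp_of_arrowOp (s := fun l m => chi c l * chi c m)
        (fun u w => mul_comm _ _) ?_ hlm
      intro u w huw
      have hu : c ≠ u := by
        rintro rfl
        exact hc.not_arrow hv huw
      rw [chi_of_ne hu, one_mul]
      exact vertexX_sComm_arrowOp c u w
    · intro j
      exact vertexSite_sComm c j pauliX_mul_pauliZ
  · refine ⟨star_vertexSite _ pauliY_conjTranspose, vertexSite_sq _ pauliY_sq, ?_, ?_⟩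
    · intro l m hlm
      refine sComm_edgeOp_of_arrowOp (s := fun l m => chi c l * chi c m)
        (fun u w => mul_comm _ _) ?_ hlm
      intro u w huw
      have hw : c ≠ w := by
        rintro rfl
        exact h ⟨u, huw⟩
      rw [chi_of_ne hw, mul_one]
      exact vertexY_sComm_arrowOp c u w
    · intro j
      exact vertexSite_sComm c j pauliY_mul_pauliZ

end EncodedRelations

end CompactEncoding
end
noncomputable section
namespace CompactEncoding

/-! ### Products of edge operators around a cycle of length four -/

section Cycle

variable {V : Type*} [DecidableEq V] {R : Type*} [Ring R] [StarRing R] [Algebra ℂ R]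
variable {adj : V → V → Prop} {E : V → V → R} {N : V → R}

omit [StarRing R] [Algebra ℂ R] in
-- Reversing the order exchanges every pair once. The four cyclically adjacent pairs anticommute and
-- the two opposite pairs commute, so the signs cancel.
lemma cycle_reverse {w x y z : R} (hxw : x * w = -(w * x)) (hyx : y * x = -(x * y))
    (hzy : z * y = -(y * z)) (hzw : z * w = -(w * z)) (hyw : y * w = w * y) (hzx : z * x = x * z) :
    z * (y * (x * w)) = w * x * y * z := by
  rw [hxw, mul_neg, mul_neg, ← mul_assoc y, hyw, ← mul_assoc z, ← mul_assoc z, hzw,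
    show -(-(w * z) * y * x) = w * (z * y * x) by noncomm_ring, hzy,
    show w * (-(y * z) * x) = -(w * (y * (z * x))) by noncomm_ring, hzx,
    show -(w * (y * (x * z))) = -(w * (y * x * z)) by noncomm_ring, hyx]
  noncomm_ring

variable (h : IsEdgeVertex adj E N) {p q r s : V} (hpq : adj p q) (hqr : adj q r) (hrs : adj r s)
  (hsp : adj s p) (hpr : p ≠ r) (hqs : q ≠ s)
include h hpq hqr hrs hsp hpr hqs

lemma IsEdgeVertex.star_cycle :
    star (E p q * E q r * E r s * E s p) = E p q * E q r * E r s * E s p := by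
  rw [star_mul, star_mul, star_mul, h.edge_star hpq, h.edge_star hqr, h.edge_star hrs,
    h.edge_star hsp]
  have npq := chi_of_ne (h.ne hpq)
  have nqr := chi_of_ne (h.ne hqr)
  have nrs := chi_of_ne (h.ne hrs)
  have nsp := chi_of_ne (h.ne hsp)
  have npr := chi_of_ne hpr
  have nqs := chi_of_ne hqs
  have nqp := (chi_comm q p).trans npq
  have nrq := (chi_comm r q).trans nqr
  have nsr := (chi_comm s r).trans nrs
  have nps := (chi_comm p s).trans nsp
  have nrp := (chi_comm r p).trans npr
  have nsq := (chi_comm s q).trans nqs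
  apply cycle_reverse
  · rw [h.edge_comm hqr hpq]; simp [*]
  · rw [h.edge_comm hrs hqr]; simp [*]
  · rw [h.edge_comm hsp hrs]; simp [*]
  · rw [h.edge_comm hsp hpq]; simp [*]
  · rw [h.edge_comm hrs hpq]; simp [*]
  · rw [h.edge_comm hsp hqr]; simp [*]

lemma IsEdgeVertex.cycle_sq :
    (E p q * E q r * E r s * E s p) * (E p q * E q r * E r s * E s p) = 1 := by
  have hs := h.star_cycle hpq hqr hrs hsp hpr hqs
  -- With the first copy written in reverse order, the product telescopes through the squares of the
  -- edges.
  nth_rewrite 1 [← hs]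
  rw [star_mul, star_mul, star_mul, h.edge_star hpq, h.edge_star hqr, h.edge_star hrs,
    h.edge_star hsp]
  have e : E s p * (E r s * (E q r * E p q)) * (E p q * E q r * E r s * E s p) =
    E s p * (E r s * (E q r * (E p q * E p q) * E q r) * E r s) * E s p := by noncomm_ring
  rw [e, h.edge_sq hpq, mul_one, h.edge_sq hqr, mul_one, h.edge_sq hrs, mul_one, h.edge_sq hsp]

omit [DecidableEq V] [StarRing R] h hpr hqs in
-- Each vertex of the cycle lies on two of its edges, so its sign `t` enters squared.
lemma commute_cycle_of_charge {T : R} {t : V → ℂ} (ht : ∀ j, t j * t j = 1)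
    (hT : ∀ {l m}, adj l m → SComm (t l * t m) T (E l m)) :
    Commute T (E p q * E q r * E r s * E s p) := by
  refine sComm_one.1 ((((hT hpq).mul_right (hT hqr)).mul_right (hT hrs)).mul_right
    (hT hsp) |>.congr ?_)
  linear_combination (t q * t q * (t r * t r) * (t s * t s)) * ht p +
    (t r * t r * (t s * t s)) * ht q + (t s * t s) * ht r + ht s

end Cycle

/-! ### Signs in the cycle operator of an odd face, for the two possible orientations. -/

section OddFaceProduct

variable {R : Type*} [Ring R]

/-- In either orientation two of the four edges are traversed against their arrows and one arrow
points up. The resulting three minus signs compensate the `-1` of `face_product`. -/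
lemma neg_face_product {x y z w : R} (h : x * y * z * w = -1) : -x * -y * -z * w = 1 := by
  simp [h]

lemma neg_face_product' {x y z w : R} (h : x * y * z * w = -1) : x * -y * z * - -w = 1 := by
  simp [h]

end OddFaceProduct

/-! ### The cycle operators -/

section CycleOp

variable {L₁ L₂ a b : ℕ}

lemma Face.corner_eq_iff (f : Face L₁ L₂) (s t s' t' : Fin 2) :
    f.corner s t = f.corner s' t' ↔ s = s' ∧ t = t' := by
  simp only [Face.corner, Prod.mk.injEq, Fin.ext_iff]
  omega

lemma Face.hasVertex_corner (f : Face L₁ L₂) (s t : Fin 2) : f.HasVertex (f.corner s t) := by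
  have hs := s.2
  have ht := t.2
  constructor <;> simp only [Face.corner] <;> omega

lemma Face.arrow_right {f : Face L₁ L₂} {t : Fin 2} (h : ¬ Even ((f.2 : ℕ) + t + b)) :
    Arrow a b (f.corner 0 t) (f.corner 1 t) := by
  refine Or.inl ⟨rfl, ?_⟩
  have h' : ¬ Even (((f.corner 0 t).2 : ℕ) + b) := h
  rw [if_neg h']
  rfl

lemma Face.arrow_left {f : Face L₁ L₂} {t : Fin 2} (h : Even ((f.2 : ℕ) + t + b)) :
    Arrow a b (f.corner 1 t) (f.corner 0 t) := by
  refine Or.inl ⟨rfl, ?_⟩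
  have h' : Even (((f.corner 1 t).2 : ℕ) + b) := h
  rw [if_pos h']
  rfl

lemma Face.arrow_up {f : Face L₁ L₂} {s : Fin 2} (h : ¬ Even ((f.1 : ℕ) + s + a)) :
    Arrow a b (f.corner s 0) (f.corner s 1) := by
  refine Or.inr ⟨rfl, ?_⟩
  have h' : ¬ Even (((f.corner s 0).1 : ℕ) + a) := h
  rw [if_neg h']
  rfl

lemma Face.arrow_down {f : Face L₁ L₂} {s : Fin 2} (h : Even ((f.1 : ℕ) + s + a)) :
    Arrow a b (f.corner s 1) (f.corner s 0) := by
  refine Or.inr ⟨rfl, ?_⟩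
  have h' : Even (((f.corner s 1).1 : ℕ) + a) := h
  rw [if_pos h']
  rfl

lemma Face.adj_bottom (f : Face L₁ L₂) : LatticeAdj (f.corner 0 0) (f.corner 1 0) :=
  Or.inl ⟨rfl, Or.inr rfl⟩

lemma Face.adj_right (f : Face L₁ L₂) : LatticeAdj (f.corner 1 0) (f.corner 1 1) :=
  Or.inr ⟨rfl, Or.inr rfl⟩

lemma Face.adj_top (f : Face L₁ L₂) : LatticeAdj (f.corner 1 1) (f.corner 0 1) :=
  Or.inl ⟨rfl, Or.inl rfl⟩

lemma Face.adj_left (f : Face L₁ L₂) : LatticeAdj (f.corner 0 1) (f.corner 0 0) :=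
  Or.inr ⟨rfl, Or.inl rfl⟩

lemma Face.corner_ne (f : Face L₁ L₂) : f.corner 0 0 ≠ f.corner 1 1 := by
  simp [Face.corner_eq_iff]

lemma Face.corner_ne' (f : Face L₁ L₂) : f.corner 1 0 ≠ f.corner 0 1 := by
  simp [Face.corner_eq_iff]

lemma cycleOp_eq (f : Face L₁ L₂) : cycleOp a b f =
    edgeOp a b (f.corner 0 0) (f.corner 1 0) * edgeOp a b (f.corner 1 0) (f.corner 1 1) *
      edgeOp a b (f.corner 1 1) (f.corner 0 1) * edgeOp a b (f.corner 0 1) (f.corner 0 0) := by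
  unfold cycleOp
  rw [Complex.I_pow_four, one_smul]

lemma cycleOp_sq (f : Face L₁ L₂) : cycleOp a b f * cycleOp a b f = 1 := by
  rw [cycleOp_eq]
  exact (isEdgeVertex_encoded a b).cycle_sq f.adj_bottom f.adj_right f.adj_top f.adj_left
    f.corner_ne f.corner_ne'

lemma commute_cycleOp_of_charge {T : QubitOp L₁ L₂ a b} {t : Vertex L₁ L₂ → ℂ}
    (ht : ∀ j, t j * t j = 1)
    (hT : ∀ {l m}, LatticeAdj l m → SComm (t l * t m) T (edgeOp a b l m)) (f : Face L₁ L₂) :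
    Commute T (cycleOp a b f) := by
  rw [cycleOp_eq]
  exact commute_cycle_of_charge f.adj_bottom f.adj_right f.adj_top f.adj_left ht hT

lemma edgeOp_commute_cycleOp {j k : Vertex L₁ L₂} (h : LatticeAdj j k) (f : Face L₁ L₂) :
    Commute (edgeOp a b j k) (cycleOp a b f) := by
  refine commute_cycleOp_of_charge (t := fun l => chi j l * chi k l) (fun l => ?_) ?_ f
  · linear_combination (chi k l * chi k l) * chi_mul_self j l + chi_mul_self k l
  · intro l m hlm
    exact SComm.congr ((isEdgeVertex_encoded a b).edge_comm h hlm) (by ring)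

lemma vertexOp_commute_cycleOp (j : Vertex L₁ L₂) (f : Face L₁ L₂) :
    Commute (vertexOp a b j) (cycleOp a b f) :=
  commute_cycleOp_of_charge (chi_mul_self j)
    (fun hlm => (isEdgeVertex_encoded a b).vertex_edge hlm j) f

lemma cornerMajorana_commute_cycleOp {c : Vertex L₁ L₂} (hc : IsOddCorner a b c)
    (f : Face L₁ L₂) : Commute (cornerMajorana a b c) (cycleOp a b f) :=
  commute_cycleOp_of_charge (chi_mul_self c) (isMajorana_cornerMajorana hc).edge f

lemma cycleOp_commute (f f' : Face L₁ L₂) : Commute (cycleOp a b f) (cycleOp a b f') := by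
  rw [cycleOp_eq f]
  exact (((edgeOp_commute_cycleOp f.adj_bottom f').mul_left
    (edgeOp_commute_cycleOp f.adj_right f')).mul_left
    (edgeOp_commute_cycleOp f.adj_top f')).mul_left (edgeOp_commute_cycleOp f.adj_left f')

/-- The commutation of `X_v` with the cycle operator of an even face. -/
lemma vertexX_sComm_cycleOp (v : Vertex L₁ L₂) {f : Face L₁ L₂} (hf : ¬ IsOddFace a b f) :
    SComm (chi v (f.corner 1 0) * chi v (f.corner 1 1) * chi v (f.corner 0 1) *
      chi v (f.corner 0 0)) (vertexSite a b v pauliX) (cycleOp a b f) := by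
  rw [cycleOp_eq]
  have hodd : ¬ Even ((f.1 : ℕ) + a + ((f.2 : ℕ) + b)) := hf
  by_cases hy : Even ((f.2 : ℕ) + b)
  -- The arrows run clockwise here and counterclockwise in the other case. Either way each corner is
  -- the head of exactly one of them, so `X` at a vertex meets exactly one sign for each corner it
  -- coincides with.
  · have hx : ¬ Even ((f.1 : ℕ) + a) := fun h => hodd (h.add hy)
    have a1 : Arrow a b (f.corner 1 0) (f.corner 0 0) := Face.arrow_left (by simpa using hy)
    have a2 : Arrow a b (f.corner 1 1) (f.corner 1 0) :=
      Face.arrow_down (by rw [Nat.even_iff] at *; simp only [Fin.val_one]; omega)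
    have a3 : Arrow a b (f.corner 0 1) (f.corner 1 1) :=
      Face.arrow_right (by rw [Nat.even_iff] at *; simp only [Fin.val_one]; omega)
    have a4 : Arrow a b (f.corner 0 0) (f.corner 0 1) := Face.arrow_up (by simpa using hx)
    rw [edgeOp_of_arrow_symm a1, edgeOp_of_arrow_symm a2, edgeOp_of_arrow_symm a3,
      edgeOp_of_arrow_symm a4]
    refine SComm.congr ((((vertexX_sComm_arrowOp v _ _).neg_right.mul_right
      (vertexX_sComm_arrowOp v _ _).neg_right).mul_right
      (vertexX_sComm_arrowOp v _ _).neg_right).mul_right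
      (vertexX_sComm_arrowOp v _ _).neg_right) (by ring)
  · have hx : Even ((f.1 : ℕ) + a) := by
      rw [Nat.even_iff] at *
      omega
    have a1 : Arrow a b (f.corner 0 0) (f.corner 1 0) := Face.arrow_right (by simpa using hy)
    have a2 : Arrow a b (f.corner 1 0) (f.corner 1 1) :=
      Face.arrow_up (by rw [Nat.even_iff] at *; simp only [Fin.val_one]; omega)
    have a3 : Arrow a b (f.corner 1 1) (f.corner 0 1) :=
      Face.arrow_left (by rw [Nat.even_iff] at *; simp only [Fin.val_one]; omega)
    have a4 : Arrow a b (f.corner 0 1) (f.corner 0 0) := Face.arrow_down (by simpa using hx)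
    rw [edgeOp_of_arrow a1, edgeOp_of_arrow a2, edgeOp_of_arrow a3, edgeOp_of_arrow a4]
    exact (((vertexX_sComm_arrowOp v _ _).mul_right (vertexX_sComm_arrowOp v _ _)).mul_right
      (vertexX_sComm_arrowOp v _ _)).mul_right (vertexX_sComm_arrowOp v _ _)

lemma vertexX_anticomm_cycleOp {f : Face L₁ L₂} (hf : ¬ IsOddFace a b f) :
    SComm (-1) (vertexSite a b (f.corner 0 0) pauliX) (cycleOp a b f) := by
  refine (vertexX_sComm_cycleOp _ hf).congr ?_
  rw [chi_self, chi_of_ne, chi_of_ne, chi_of_ne] <;> simp [Face.corner_eq_iff]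

lemma vertexX_commute_cycleOp {v : Vertex L₁ L₂} {f : Face L₁ L₂} (hf : ¬ IsOddFace a b f)
    (hv : ¬ f.HasVertex v) : Commute (vertexSite a b v pauliX) (cycleOp a b f) := by
  refine sComm_one.1 ((vertexX_sComm_cycleOp _ hf).congr ?_)
  have hne : ∀ s t, v ≠ f.corner s t := by
    rintro s t rfl
    exact hv (f.hasVertex_corner s t)
  simp only [chi_of_ne (hne _ _), mul_one]

/-- The cycle operator anticommutes with the invertible `X` at a corner, which the identity does
not. -/
lemma cycleOp_ne_one {f : Face L₁ L₂} (hf : ¬ IsOddFace a b f) : cycleOp a b f ≠ 1 := by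
  intro h
  have h1 := vertexX_anticomm_cycleOp hf
  rw [h] at h1
  unfold SComm at h1
  rw [mul_one, one_mul] at h1
  have h2 : vertexSite a b (f.corner 0 0) pauliX = 0 :=
    eq_zero_of_eq_neg_self (h1.trans (neg_one_smul ℂ _))
  have h3 := vertexSite_sq (a := a) (b := b) (f.corner 0 0) pauliX_sq
  rw [h2, mul_zero] at h3
  exact zero_ne_one h3

lemma arrowOp_horizontal {u w : Vertex L₁ L₂} (h : u.2 = w.2) : arrowOp a b u w =
    vertexSite a b u pauliX * vertexSite a b w pauliY * faceSite a b u w pauliY :=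
  if_pos h

lemma arrowOp_down {u w : Vertex L₁ L₂} (h : w.2 < u.2) : arrowOp a b u w =
    vertexSite a b u pauliX * vertexSite a b w pauliY * faceSite a b u w pauliX :=
  (if_neg h.ne').trans (if_pos h)

lemma arrowOp_up {u w : Vertex L₁ L₂} (h : u.2 < w.2) : arrowOp a b u w =
    -(vertexSite a b u pauliX * vertexSite a b w pauliY * faceSite a b u w pauliX) :=
  (if_neg h.ne).trans (if_neg h.asymm)

lemma faceSite_corner (f : {f : Face L₁ L₂ // IsOddFace a b f}) {s t s' t' : Fin 2}
    (h : LatticeAdj (f.1.corner s t) (f.1.corner s' t')) (M : Matrix (Fin 2) (Fin 2) ℂ) :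
    faceSite a b (f.1.corner s t) (f.1.corner s' t') M = siteOp (Sum.inr f) M :=
  faceSite_of_hasVertex h f (f.1.hasVertex_corner s t) (f.1.hasVertex_corner s' t') M

/-- On an odd face two opposite corners, `s` and `s'`, are both tails or both heads, and the other
two are the reverse. Leaving `M` and `N` open covers both orientations. -/
lemma odd_face_product (f : {f : Face L₁ L₂ // IsOddFace a b f}) {s s' t t' : Vertex L₁ L₂}
    {M N : Matrix (Fin 2) (Fin 2) ℂ} (hM : M * M = 1) (hN : N * N = 1)
    (hst : s ≠ t) (hs't : s' ≠ t) (hs't' : s' ≠ t') :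
    vertexSite a b s M * vertexSite a b t N * siteOp (Sum.inr f) pauliY *
      (vertexSite a b s M * vertexSite a b t' N * siteOp (Sum.inr f) pauliX) *
      (vertexSite a b s' M * vertexSite a b t' N * siteOp (Sum.inr f) pauliY) *
      (vertexSite a b s' M * vertexSite a b t N * siteOp (Sum.inr f) pauliX) = -1 := by
  have hfv : ∀ (v : Vertex L₁ L₂) (M N : Matrix (Fin 2) (Fin 2) ℂ),
      Commute (siteOp (Sum.inr f) M) (vertexSite a b v N) := fun v M N =>
    siteOp_commute (by simp) M N
  apply face_product
  · exact vertexSite_sq _ hM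
  · exact vertexSite_sq _ hM
  · exact vertexSite_sq _ hN
  · exact vertexSite_sq _ hN
  · rw [siteOp_mul, pauliY_sq, siteOp_one]
  · rw [siteOp_mul, pauliX_sq, siteOp_one]
  · rw [siteOp_mul, siteOp_mul, pauliX_mul_pauliY, siteOp_neg]
  · exact vertexSite_commute_of_ne hst.symm _ _
  · exact vertexSite_commute_of_ne hs't.symm _ _
  · exact vertexSite_commute_of_ne hs't'.symm _ _
  all_goals exact hfv _ _ _

/-- Each vertex Pauli occurs in two of the edges and cancels, and the face qubit leaves `YXYX = -1`.
This is made good by the signs of the edges, which is the purpose of the minus sign for arrows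
pointing up. -/
lemma cycleOp_eq_one {f : Face L₁ L₂} (hf : IsOddFace a b f) : cycleOp a b f = 1 := by
  rw [cycleOp_eq]
  have hodd : Even ((f.1 : ℕ) + a + ((f.2 : ℕ) + b)) := hf
  have hh : ∀ s s' t, (f.corner s t).2 = (f.corner s' t).2 := fun _ _ _ => rfl
  have hlt : ∀ s s', (f.corner s 0).2 < (f.corner s' 1).2 := fun s s' => by
    rw [Fin.lt_def]
    exact Nat.lt_succ_self _
  by_cases hy : Even ((f.2 : ℕ) + b)
  · have hx : Even ((f.1 : ℕ) + a) := by
      rw [Nat.even_iff] at *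
      omega
    have a1 : Arrow a b (f.corner 1 0) (f.corner 0 0) := Face.arrow_left (by simpa using hy)
    have a2 : Arrow a b (f.corner 1 0) (f.corner 1 1) :=
      Face.arrow_up (by rw [Nat.even_iff] at *; simp only [Fin.val_one]; omega)
    have a3 : Arrow a b (f.corner 0 1) (f.corner 1 1) :=
      Face.arrow_right (by rw [Nat.even_iff] at *; simp only [Fin.val_one]; omega)
    have a4 : Arrow a b (f.corner 0 1) (f.corner 0 0) := Face.arrow_down (by simpa using hx)
    rw [edgeOp_of_arrow_symm a1, edgeOp_of_arrow a2, edgeOp_of_arrow_symm a3,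
      edgeOp_of_arrow a4, arrowOp_horizontal (hh 1 0 0), arrowOp_up (hlt _ _),
      arrowOp_horizontal (hh 0 1 1),
      arrowOp_down (hlt _ _), faceSite_corner ⟨f, hf⟩ a1.latticeAdj,
      faceSite_corner ⟨f, hf⟩ a2.latticeAdj, faceSite_corner ⟨f, hf⟩ a3.latticeAdj,
      faceSite_corner ⟨f, hf⟩ a4.latticeAdj]
    apply neg_face_product
    apply odd_face_product _ pauliX_sq pauliY_sq <;> simp [Face.corner_eq_iff]
  · have hx : ¬ Even ((f.1 : ℕ) + a) := by
      rw [Nat.even_iff] at *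
      omega
    have a1 : Arrow a b (f.corner 0 0) (f.corner 1 0) := Face.arrow_right (by simpa using hy)
    have a2 : Arrow a b (f.corner 1 1) (f.corner 1 0) :=
      Face.arrow_down (by rw [Nat.even_iff] at *; simp only [Fin.val_one]; omega)
    have a3 : Arrow a b (f.corner 1 1) (f.corner 0 1) :=
      Face.arrow_left (by rw [Nat.even_iff] at *; simp only [Fin.val_one]; omega)
    have a4 : Arrow a b (f.corner 0 0) (f.corner 0 1) := Face.arrow_up (by simpa using hx)
    rw [edgeOp_of_arrow a1, edgeOp_of_arrow_symm a2, edgeOp_of_arrow a3,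
      edgeOp_of_arrow_symm a4, arrowOp_horizontal (hh 0 1 0), arrowOp_down (hlt _ _),
      arrowOp_horizontal (hh 1 0 1), arrowOp_up (hlt _ _), faceSite_corner ⟨f, hf⟩ a1.latticeAdj,
      faceSite_corner ⟨f, hf⟩ a2.latticeAdj, faceSite_corner ⟨f, hf⟩ a3.latticeAdj,
      faceSite_corner ⟨f, hf⟩ a4.latticeAdj]
    apply neg_face_product'
    -- In this orientation the corners `s`, `s'` are heads; swapping the two vertex factors gives
    -- the shape of `odd_face_product` with `M = Y` and `N = X`.
    have hXY : ∀ s t s' t', f.corner s t ≠ f.corner s' t' →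
        vertexSite a b (f.corner s t) pauliX * vertexSite a b (f.corner s' t') pauliY =
        vertexSite a b (f.corner s' t') pauliY * vertexSite a b (f.corner s t) pauliX :=
      fun s t s' t' h => (vertexSite_commute_of_ne h pauliX pauliY).eq
    rw [hXY 0 0 1 0 (by simp [Face.corner_eq_iff]), hXY 1 1 1 0 (by simp [Face.corner_eq_iff]),
      hXY 1 1 0 1 (by simp [Face.corner_eq_iff]), hXY 0 0 0 1 (by simp [Face.corner_eq_iff])]
    apply odd_face_product _ pauliY_sq pauliX_sq <;> simp [Face.corner_eq_iff]

lemma cycleOp_ne_one_iff (f : Face L₁ L₂) : cycleOp a b f ≠ 1 ↔ ¬ IsOddFace a b f :=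
  ⟨fun h hf => h (cycleOp_eq_one hf), cycleOp_ne_one⟩

end CycleOp

end CompactEncoding
end
noncomputable section
namespace CompactEncoding

/-! ### The dimension of a stabilizer space -/

section Stabilizer

variable {W : Type*} [AddCommGroup W] [Module ℂ W] [FiniteDimensional ℂ W] {ι : Type*}

/-- The joint `+1` eigenspace of a finite family of operators. -/
def stabilized (C : ι → W →ₗ[ℂ] W) (S : Finset ι) : Submodule ℂ W :=
  ⨅ i ∈ S, LinearMap.eqLocus (C i) LinearMap.id

omit [FiniteDimensional ℂ W] in
lemma mem_stabilized {C : ι → W →ₗ[ℂ] W} {S : Finset ι} {ψ : W} :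
    ψ ∈ stabilized C S ↔ ∀ i ∈ S, C i ψ = ψ := by
  simp [stabilized, Submodule.mem_iInf, LinearMap.mem_eqLocus]

/-- An involution `D` of `K` which anticommutes with an involution `c` of `K` exchanges the
eigenspaces of `c`. -/
lemma finrank_inf_eqLocus_mul_two (K : Submodule ℂ W) (c D : W →ₗ[ℂ] W)
    (hc : ∀ ψ, c (c ψ) = ψ) (hD : ∀ ψ, D (D ψ) = ψ) (hcD : ∀ ψ, D (c ψ) = -c (D ψ))
    (hcK : ∀ ψ ∈ K, c ψ ∈ K) (hDK : ∀ ψ ∈ K, D ψ ∈ K) :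
    Module.finrank ℂ (K ⊓ LinearMap.eqLocus c LinearMap.id : Submodule ℂ W) * 2 =
      Module.finrank ℂ K := by
  set P : Submodule ℂ W := K ⊓ LinearMap.eqLocus c LinearMap.id with hP
  set M : Submodule ℂ W := K ⊓ LinearMap.eqLocus c (-LinearMap.id) with hM
  have memP : ∀ ψ, ψ ∈ P ↔ ψ ∈ K ∧ c ψ = ψ := fun ψ => by
    simp [hP, LinearMap.mem_eqLocus]
  have memM : ∀ ψ, ψ ∈ M ↔ ψ ∈ K ∧ c ψ = -ψ := fun ψ => by
    simp [hM, LinearMap.mem_eqLocus]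
  let e : W ≃ₗ[ℂ] W := LinearEquiv.ofInvolutive D hD
  have hPM : Module.finrank ℂ P ≤ Module.finrank ℂ M := by
    rw [← LinearEquiv.finrank_map_eq e P]
    apply Submodule.finrank_mono
    rintro _ ⟨ψ, hψ, rfl⟩
    obtain ⟨h1, h2⟩ := (memP ψ).1 hψ
    refine (memM _).2 ⟨hDK ψ h1, ?_⟩
    change c (D ψ) = -D ψ
    rw [eq_neg_iff_add_eq_zero, ← neg_eq_iff_add_eq_zero, ← hcD, h2]
  have hMP : Module.finrank ℂ M ≤ Module.finrank ℂ P := by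
    rw [← LinearEquiv.finrank_map_eq e M]
    apply Submodule.finrank_mono
    rintro _ ⟨ψ, hψ, rfl⟩
    obtain ⟨h1, h2⟩ := (memM ψ).1 hψ
    refine (memP _).2 ⟨hDK ψ h1, ?_⟩
    change c (D ψ) = D ψ
    have := hcD ψ
    rw [h2, map_neg] at this
    exact (neg_injective this).symm
  have hsup : P ⊔ M = K := by
    apply le_antisymm (sup_le inf_le_left inf_le_left)
    intro ψ hψ
    rw [Submodule.mem_sup]
    refine ⟨(1 / 2 : ℂ) • (ψ + c ψ), (memP _).2 ⟨?_, ?_⟩, (1 / 2 : ℂ) • (ψ - c ψ),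
      (memM _).2 ⟨?_, ?_⟩, ?_⟩
    · exact K.smul_mem _ (K.add_mem hψ (hcK ψ hψ))
    · rw [map_smul, map_add, hc, add_comm]
    · exact K.smul_mem _ (K.sub_mem hψ (hcK ψ hψ))
    · rw [map_smul, map_sub, hc, ← smul_neg, neg_sub]
    · rw [← smul_add, add_add_sub_cancel, ← two_smul ℂ, smul_smul]
      norm_num
  have hinf : P ⊓ M = ⊥ := by
    rw [eq_bot_iff]
    intro ψ hψ
    obtain ⟨h1, h2⟩ := Submodule.mem_inf.1 hψ
    have h3 := ((memP ψ).1 h1).2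
    rw [((memM ψ).1 h2).2] at h3
    exact (Submodule.mem_bot ℂ).2 (eq_zero_of_eq_neg_self h3.symm)
  have h := Submodule.finrank_sup_add_finrank_inf_eq P M
  rw [hsup, hinf, finrank_bot] at h
  omega

/-- The dimension of the joint `+1` eigenspace of commuting independent involutions. -/
lemma finrank_stabilized [DecidableEq ι] (C D : ι → W →ₗ[ℂ] W) (rank : ι → ℕ)
    (hC : ∀ i ψ, C i (C i ψ) = ψ) (hD : ∀ i ψ, D i (D i ψ) = ψ)
    (hCC : ∀ i j ψ, C i (C j ψ) = C j (C i ψ)) (hDC : ∀ i ψ, D i (C i ψ) = -C i (D i ψ))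
    (hne : ∀ i j, i ≠ j → rank i ≤ rank j → ∀ ψ, D i (C j ψ) = C j (D i ψ)) (S : Finset ι) :
    Module.finrank ℂ (stabilized C S) * 2 ^ S.card = Module.finrank ℂ W := by
  -- Inserting the element of smallest rank last ensures that its `D i` commutes with all `C j`
  -- already imposed, so it preserves their eigenspace and each insertion halves the dimension.
  induction S using Finset.induction_on_min_value rank with
  | empty =>
    have : stabilized C ∅ = ⊤ := by simp [stabilized]
    rw [this]
    simp
  | insert i S hi hmin ih =>
    have hS : stabilized C (insert i S) =
        stabilized C S ⊓ LinearMap.eqLocus (C i) LinearMap.id := by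
      rw [stabilized, Finset.iInf_insert, inf_comm]
      rfl
    have h := finrank_inf_eqLocus_mul_two (stabilized C S) (C i) (D i) (hC i) (hD i) (hDC i) (by
        intro ψ hψ
        rw [mem_stabilized] at *
        intro j hj
        rw [hCC, hψ j hj]) (by
        intro ψ hψ
        rw [mem_stabilized] at *
        intro j hj
        have hij : i ≠ j := fun h => hi (h ▸ hj)
        rw [← hne i j hij (hmin j hj), hψ j hj])
    rw [hS, Finset.card_insert_of_notMem hi, pow_succ, mul_comm (2 ^ S.card), ← mul_assoc, h, ih]

end Stabilizer

/-! ### Counting faces -/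

section Counting

variable {L₁ L₂ : ℕ}

/-- Reflection of the residues modulo `2`. -/
def flipParity {p : ℕ} (hp : Even p) (x : Fin p) : Fin p :=
  ⟨if (x : ℕ) % 2 = 0 then x + 1 else x - 1, by
    have := x.2
    rw [Nat.even_iff] at hp
    split_ifs <;> omega⟩

lemma flipParity_flipParity {p : ℕ} (hp : Even p) (x : Fin p) :
    flipParity hp (flipParity hp x) = x := by
  ext
  simp only [flipParity]
  split_ifs <;> omega

lemma even_flipParity_add {p : ℕ} (hp : Even p) (x : Fin p) (n : ℕ) :
    Even ((flipParity hp x : ℕ) + n) ↔ ¬ Even ((x : ℕ) + n) := by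
  simp only [flipParity, Nat.even_iff]
  split_ifs <;> omega

/-- One side of the array of faces has even length; exchanging neighbouring columns or rows in pairs
reverses all labels. -/
lemma exists_face_equiv (hF : Even ((L₁ - 1) * (L₂ - 1))) (a b : ℕ) :
    ∃ e : Face L₁ L₂ ≃ Face L₁ L₂, ∀ f, IsOddFace a b f ↔ ¬ IsOddFace a b (e f) := by
  rcases Nat.even_mul.1 hF with hp | hp
  · refine ⟨⟨fun f => (flipParity hp f.1, f.2), fun f => (flipParity hp f.1, f.2), ?_, ?_⟩, ?_⟩
    · intro f
      simp [flipParity_flipParity]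
    · intro f
      simp [flipParity_flipParity]
    · intro f
      have := even_flipParity_add hp f.1 (a + (f.2 + b))
      simp only [IsOddFace, Equiv.coe_fn_mk, add_assoc]
      rw [this, not_not]
  · refine ⟨⟨fun f => (f.1, flipParity hp f.2), fun f => (f.1, flipParity hp f.2), ?_, ?_⟩, ?_⟩
    · intro f
      simp [flipParity_flipParity]
    · intro f
      simp [flipParity_flipParity]
    · intro f
      have := even_flipParity_add hp f.2 (b + (f.1 + a))
      simp only [IsOddFace, Equiv.coe_fn_mk, add_comm ((f.1 : ℕ) + a), add_assoc]
      rw [this, not_not]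

lemma card_oddFace (hF : Even ((L₁ - 1) * (L₂ - 1))) (a b : ℕ) :
    Fintype.card {f : Face L₁ L₂ // IsOddFace a b f} = (L₁ - 1) * (L₂ - 1) / 2 ∧
    Fintype.card {f : Face L₁ L₂ // ¬ IsOddFace a b f} = (L₁ - 1) * (L₂ - 1) / 2 := by
  obtain ⟨e, he⟩ := exists_face_equiv hF a b
  have h1 := Fintype.card_congr (e.subtypeEquiv (p := fun f => IsOddFace a b f)
    (q := fun f => ¬ IsOddFace a b f) he)
  have h2 := Fintype.card_subtype_compl (fun f : Face L₁ L₂ => IsOddFace a b f)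
  have h3 := Fintype.card_subtype_le (fun f : Face L₁ L₂ => IsOddFace a b f)
  rw [Fintype.card_prod, Fintype.card_fin, Fintype.card_fin] at h2 h3
  omega

/-- A corner touches at most one face. Along a side with an even positive number of faces the two
end faces have opposite labels, so one of them is odd; if there are no faces, every corner is odd.
-/
lemma exists_oddCorner (hL₁ : 1 ≤ L₁) (hL₂ : 1 ≤ L₂) (hF : Even ((L₁ - 1) * (L₂ - 1)))
    (a b : ℕ) : ∃ c : Vertex L₁ L₂, IsOddCorner a b c := by
  rcases Nat.even_mul.1 hF with hp | hp
  · by_cases hab : Even (a + b)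
    · refine ⟨(⟨0, by omega⟩, ⟨0, by omega⟩), Or.inl rfl, Or.inl rfl, ?_⟩
      intro f hf
      unfold Face.HasVertex at hf
      unfold IsOddFace
      rw [Nat.even_iff] at *
      simp only at hf
      omega
    · refine ⟨(⟨L₁ - 1, by omega⟩, ⟨0, by omega⟩), Or.inr ?_, Or.inl rfl, ?_⟩
      · simp only
        omega
      · intro f hf
        have h1 := f.1.2
        unfold Face.HasVertex at hf
        unfold IsOddFace
        rw [Nat.even_iff] at *
        simp only at hf
        omega
  · by_cases hab : Even (a + b)
    · refine ⟨(⟨0, by omega⟩, ⟨0, by omega⟩), Or.inl rfl, Or.inl rfl, ?_⟩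
      intro f hf
      unfold Face.HasVertex at hf
      unfold IsOddFace
      rw [Nat.even_iff] at *
      simp only at hf
      omega
    · refine ⟨(⟨0, by omega⟩, ⟨L₂ - 1, by omega⟩), Or.inl rfl, Or.inr ?_, ?_⟩
      · simp only
        omega
      · intro f hf
        have h1 := f.2.2
        unfold Face.HasVertex at hf
        unfold IsOddFace
        rw [Nat.even_iff] at *
        simp only at hf
        omega

end Counting

/-! ### The code space -/

section CodeSpace

variable {L₁ L₂ a b : ℕ}

lemma mem_codeSpace {ψ : QubitSpace (Qubit L₁ L₂ a b)} :
    ψ ∈ codeSpace L₁ L₂ a b ↔ ∀ f : Face L₁ L₂, cycleOp a b f ψ = ψ := by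
  constructor
  · intro h f
    by_cases hf : cycleOp a b f = 1
    · rw [hf]
      rfl
    · exact h f hf
  · intro h f _
    exact h f

lemma apply_mem_codeSpace {T : QubitOp L₁ L₂ a b}
    (hT : ∀ f : Face L₁ L₂, Commute T (cycleOp a b f)) {ψ : QubitSpace (Qubit L₁ L₂ a b)}
    (hψ : ψ ∈ codeSpace L₁ L₂ a b) : T ψ ∈ codeSpace L₁ L₂ a b := by
  rw [mem_codeSpace] at *
  intro f
  have := congrArg (fun S => S ψ) (hT f).eq
  refine this.symm.trans ?_
  change T (cycleOp a b f ψ) = T ψ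
  rw [hψ f]

lemma card_qubit (hF : Even ((L₁ - 1) * (L₂ - 1))) (a b : ℕ) :
    Fintype.card (Qubit L₁ L₂ a b) = L₁ * L₂ + (L₁ - 1) * (L₂ - 1) / 2 := by
  rw [Fintype.card_sum, (card_oddFace hF a b).1]
  simp

/-- The `n_F / 2` even cycle operators are commuting independent involutions, so they divide the
dimension `2 ^ (m + n_F / 2)` by `2 ^ (n_F / 2)`. -/
lemma finrank_codeSpace (hF : Even ((L₁ - 1) * (L₂ - 1))) (a b : ℕ) :
    Module.finrank ℂ (codeSpace L₁ L₂ a b) = 2 ^ (L₁ * L₂) := by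
  have happly : ∀ {S T U V : QubitOp L₁ L₂ a b}, S * T = U * V → ∀ ψ, S (T ψ) = U (V ψ) :=
    fun h ψ => congrArg (fun X => X ψ) h
  have hcode : codeSpace L₁ L₂ a b = stabilized
      (fun f : {f : Face L₁ L₂ // ¬ IsOddFace a b f} =>
        (cycleOp a b f.1 : QubitSpace (Qubit L₁ L₂ a b) →ₗ[ℂ] _)) Finset.univ := by
    ext ψ
    rw [mem_codeSpace, mem_stabilized]
    constructor
    · intro h f _
      exact h f.1
    · intro h f
      by_cases hf : IsOddFace a b f
      · rw [cycleOp_eq_one hf]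
        rfl
      · exact h ⟨f, hf⟩ (Finset.mem_univ _)
  have h := finrank_stabilized
    (fun f : {f : Face L₁ L₂ // ¬ IsOddFace a b f} =>
        (cycleOp a b f.1 : QubitSpace (Qubit L₁ L₂ a b) →ₗ[ℂ] _))
    -- The flip for `f` is `X` at its lower left vertex, and the rank is the column of the face.
    -- Among faces in this or a later column, that vertex touches only `f` and the face below it,
    -- which is odd.
    (fun f => (vertexSite a b (f.1.corner 0 0) pauliX : QubitSpace (Qubit L₁ L₂ a b) →ₗ[ℂ] _))
    (fun f => (f.1.1 : ℕ))
    (fun f ψ => congrArg (fun X => X ψ) (cycleOp_sq f.1))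
    (fun f ψ => congrArg (fun X => X ψ) (vertexSite_sq (f.1.corner 0 0) pauliX_sq))
    (fun f f' => happly (cycleOp_commute f.1 f'.1).eq)
    (fun f ψ => by
      have h1 := vertexX_anticomm_cycleOp f.2
      have h2 := congrArg (fun X => X ψ) h1
      exact h2.trans (neg_one_smul ℂ _))
    (fun f f' hne hle => happly (vertexX_commute_cycleOp f'.2 (by
      rintro ⟨h1, h2⟩
      have hf := f.2
      have hf' := f'.2
      unfold IsOddFace at hf hf'
      rw [Nat.even_iff] at hf hf'
      simp only [Face.corner, Fin.val_zero, add_zero] at h1 h2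
      apply hne
      ext <;> omega)).eq) Finset.univ
  rw [← hcode, Finset.card_univ, (card_oddFace hF a b).2, finrank_euclideanSpace,
    Fintype.card_fun, Fintype.card_fin, card_qubit hF, pow_add] at h
  exact Nat.eq_of_mul_eq_mul_right (by positivity) h

end CodeSpace

/-! ### Compression to a subspace -/

section Compression

variable {H : Type*} [NormedAddCommGroup H] [InnerProductSpace ℂ H] [CompleteSpace H]
  (K : Submodule ℂ H) [CompleteSpace K]

/-- The compression of an operator to a subspace. -/
def compress (T : H →L[ℂ] H) : K →L[ℂ] K :=
  ContinuousLinearMap.adjoint K.subtypeL ∘L T ∘L K.subtypeL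

variable {K}

lemma compress_apply {T : H →L[ℂ] H} (hT : ∀ ψ ∈ K, T ψ ∈ K) (ψ : K) :
    (compress K T ψ : H) = T ψ := by
  have : compress K T ψ = ⟨T ψ, hT ψ ψ.2⟩ := by
    apply ext_inner_left ℂ
    intro φ
    change inner ℂ φ (ContinuousLinearMap.adjoint K.subtypeL (T ψ)) = _
    rw [ContinuousLinearMap.adjoint_inner_right]
    rfl
  rw [this]

/-- Compression with the adjoint of the inclusion, unlike restriction, respects adjoints without any
invariance of `K`. -/
lemma star_compress (T : H →L[ℂ] H) : star (compress K T) = compress K (star T) := by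
  unfold compress
  simp only [ContinuousLinearMap.star_eq_adjoint, ContinuousLinearMap.adjoint_comp,
    ContinuousLinearMap.adjoint_adjoint]
  rfl

lemma compress_smul (c : ℂ) (T : H →L[ℂ] H) : compress K (c • T) = c • compress K T := by
  ext ψ
  simp [compress]

lemma compress_neg (T : H →L[ℂ] H) : compress K (-T) = -compress K T := by
  ext ψ
  simp [compress]

lemma compress_one : compress K (1 : H →L[ℂ] H) = 1 := by
  ext ψ
  exact compress_apply (fun _ h => h) ψ

/-- Only the factor acting first has to preserve `K`. -/
lemma compress_mul (S : H →L[ℂ] H) {T : H →L[ℂ] H} (hT : ∀ ψ ∈ K, T ψ ∈ K) :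
    compress K S * compress K T = compress K (S * T) := by
  ext ψ
  change ((ContinuousLinearMap.adjoint K.subtypeL (S (compress K T ψ : H)) : K) : H) = _
  rw [compress_apply hT]
  rfl

variable {V : Type*} [DecidableEq V] {adj : V → V → Prop} {E : V → V → H →L[ℂ] H}
  {N : V → H →L[ℂ] H}

lemma IsEdgeVertex.compress (h : IsEdgeVertex adj E N)
    (hE : ∀ {j k}, adj j k → ∀ ψ ∈ K, E j k ψ ∈ K) (hN : ∀ j, ∀ ψ ∈ K, N j ψ ∈ K) :
    IsEdgeVertex adj (fun j k => compress K (E j k)) (fun j => compress K (N j)) where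
  symm := h.symm
  ne := h.ne
  edge_star := fun hjk => by rw [star_compress, h.edge_star hjk]
  edge_sq := fun hjk => by rw [compress_mul _ (hE hjk), h.edge_sq hjk, compress_one]
  edge_swap := fun hjk => by rw [h.edge_swap hjk, compress_neg]
  edge_comm := fun hjk hlm => by
    rw [compress_mul _ (hE hlm), compress_mul _ (hE hjk), h.edge_comm hjk hlm, compress_smul]
  vertex_star := fun j => by rw [star_compress, h.vertex_star]
  vertex_sq := fun j => by rw [compress_mul _ (hN j), h.vertex_sq, compress_one]
  vertex_comm := fun j k => by
    rw [compress_mul _ (hN k), compress_mul _ (hN j), h.vertex_comm]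
  vertex_edge := fun hlm j => by
    rw [compress_mul _ (hE hlm), compress_mul _ (hN j), h.vertex_edge hlm, compress_smul]

lemma IsMajorana.compress {c : V} {g : H →L[ℂ] H} (h : IsMajorana adj E N c g)
    (hE : ∀ {j k}, adj j k → ∀ ψ ∈ K, E j k ψ ∈ K) (hN : ∀ j, ∀ ψ ∈ K, N j ψ ∈ K)
    (hg : ∀ ψ ∈ K, g ψ ∈ K) :
    IsMajorana adj (fun j k => compress K (E j k)) (fun j => compress K (N j)) c
      (compress K g) where
  star_eq := by rw [star_compress, h.star_eq]
  sq := by rw [compress_mul _ hg, h.sq, compress_one]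
  edge := fun hlm => by
    rw [compress_mul _ (hE hlm), compress_mul _ hg, h.edge hlm, compress_smul]
  vertex := fun j => by
    rw [compress_mul _ (hN j), compress_mul _ hg, h.vertex, compress_smul]

end Compression

end CompactEncoding
end
noncomputable section
namespace CompactEncoding

/-! ### The encoding -/

section Encoding

section StarAlgEquiv

variable {R S : Type*} [Ring R] [StarRing R] [Algebra ℂ R] [Ring S] [StarRing S] [Algebra ℂ S]
  (μ : R ≃⋆ₐ[ℂ] S)

lemma starAlgEquiv_add_star (x : R) : μ (x + star x) = μ x + star (μ x) := by
  rw [map_add, map_star]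

lemma starAlgEquiv_smul_sub_star (c : ℂ) (x : R) :
    μ (c • (x - star x)) = c • (μ x - star (μ x)) := by
  rw [map_smul, map_sub, map_star]

lemma starAlgEquiv_smul_mul (c : ℂ) (x y : R) : μ (c • (x * y)) = c • (μ x * μ y) := by
  rw [map_smul, map_mul]

end StarAlgEquiv

/-- A family of Majorana operators on a space of the smallest possible dimension is unitarily
equivalent to the one of the Fock space. -/
theorem IsMajoranaFamily.exists_fock_equiv {V : Type*} [Fintype V] [DecidableEq V] {H : Type*}
    [NormedAddCommGroup H] [InnerProductSpace ℂ H] [CompleteSpace H] [FiniteDimensional ℂ H]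
    {adj : V → V → Prop} {E : V → V → H →L[ℂ] H} {N G : V → H →L[ℂ] H}
    (hG : IsMajoranaFamily adj E N G) (h : IsEdgeVertex adj E N)
    (hdim : Module.finrank ℂ H = 2 ^ Fintype.card V) :
    ∃ T : Fock V ≃ₗᵢ[ℂ] H, (∀ j k, adj j k → T.conjStarAlgEquiv (fermiEdge j k) = E j k) ∧
      (∀ j, T.conjStarAlgEquiv (fermiVertex j) = N j) ∧
      ∀ j, T.conjStarAlgEquiv (majorana j) = G j := by
  have hA : IsCAR (lowering G N) := ⟨hG.lowering_anticomm h, hG.lowering_anticomm_star h⟩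
  obtain ⟨T, hT⟩ := hA.exists_fock_equiv hdim
  -- `T` intertwines `lowering` with `annihilate`. The Majorana, edge and vertex operators are
  -- polynomials in the annihilation operators and their adjoints, so their images follow.
  have hann : ∀ i, T.symm.conjStarAlgEquiv (annihilate i) = lowering G N i := by
    intro i
    ext1 ψ
    rw [LinearIsometryEquiv.conjStarAlgEquiv_apply_apply, LinearIsometryEquiv.symm_symm, ← hT,
      T.symm_apply_apply]
  have hmaj : ∀ i, T.symm.conjStarAlgEquiv (majorana i) = G i := by
    intro i
    have e := starAlgEquiv_add_star T.symm.conjStarAlgEquiv (annihilate i)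
    rw [hann, hG.lowering_add_star h] at e
    exact e
  refine ⟨T.symm, fun j k hjk => ?_, fun j => ?_, hmaj⟩
  · have e := starAlgEquiv_smul_mul T.symm.conjStarAlgEquiv (-Complex.I) (majorana j) (majorana k)
    rw [hmaj, hmaj, hG.edge_eq hjk] at e
    exact e
  · have e := starAlgEquiv_smul_mul T.symm.conjStarAlgEquiv (-Complex.I) (majorana j)
      (majoranaBar j)
    have e' := starAlgEquiv_smul_sub_star T.symm.conjStarAlgEquiv (-Complex.I) (annihilate j)
    rw [hann] at e'
    have e'' := hG.vertex_eq h j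
    rw [hmaj, show T.symm.conjStarAlgEquiv (majoranaBar j) = _ from e'] at e
    rw [hG.lowering_add_star h j] at e''
    exact e.trans e''

variable {L₁ L₂ a b : ℕ}

/-- The algebra of the fermions is represented faithfully on the code space. -/
theorem exists_encoding (hF : Even ((L₁ - 1) * (L₂ - 1))) {c : Vertex L₁ L₂}
    (hc : IsOddCorner a b c) :
    ∃ T : Fock (Vertex L₁ L₂) ≃ₗᵢ[ℂ] codeSpace L₁ L₂ a b,
      (∀ j k : Vertex L₁ L₂, LatticeAdj j k → ∀ ψ : codeSpace L₁ L₂ a b,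
        (T.conjStarAlgEquiv (fermiEdge j k) ψ : QubitSpace (Qubit L₁ L₂ a b)) =
          edgeOp a b j k ψ) ∧
      (∀ (j : Vertex L₁ L₂) (ψ : codeSpace L₁ L₂ a b),
        (T.conjStarAlgEquiv (fermiVertex j) ψ : QubitSpace (Qubit L₁ L₂ a b)) =
          vertexOp a b j ψ) ∧
      (∀ ψ : codeSpace L₁ L₂ a b,
        (T.conjStarAlgEquiv (majorana c) ψ : QubitSpace (Qubit L₁ L₂ a b)) =
          cornerMajorana a b c ψ) := by
  let K := codeSpace L₁ L₂ a b
  have hE : ∀ {j k : Vertex L₁ L₂}, LatticeAdj j k → ∀ ψ ∈ K, edgeOp a b j k ψ ∈ K :=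
    fun hjk ψ hψ => apply_mem_codeSpace (edgeOp_commute_cycleOp hjk) hψ
  have hN : ∀ j : Vertex L₁ L₂, ∀ ψ ∈ K, vertexOp a b j ψ ∈ K :=
    fun j ψ hψ => apply_mem_codeSpace (vertexOp_commute_cycleOp j) hψ
  have hg : ∀ ψ ∈ K, cornerMajorana a b c ψ ∈ K :=
    fun ψ hψ => apply_mem_codeSpace (cornerMajorana_commute_cycleOp hc) hψ
  have hrel := (isEdgeVertex_encoded (L₁ := L₁) (L₂ := L₂) a b).compress (K := K) hE hN
  have hmaj := (isMajorana_cornerMajorana hc).compress (K := K) hE hN hg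
  -- On the code space the connection is flat: even cycles act trivially by its definition, odd ones
  -- because they are the identity.
  have hface : ∀ f : Face L₁ L₂,
      compress K (edgeOp a b (f.corner 0 0) (f.corner 1 0)) *
      compress K (edgeOp a b (f.corner 1 0) (f.corner 1 1)) *
      compress K (edgeOp a b (f.corner 1 1) (f.corner 0 1)) *
      compress K (edgeOp a b (f.corner 0 1) (f.corner 0 0)) = 1 := by
    intro f
    rw [compress_mul _ (hE f.adj_right), compress_mul _ (hE f.adj_top),
      compress_mul _ (hE f.adj_left), ← cycleOp_eq]
    ext1 ψ
    apply Subtype.ext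
    have hcyc : ∀ φ ∈ K, cycleOp a b f φ = φ := fun φ hφ => mem_codeSpace.1 hφ f
    rw [compress_apply (fun φ hφ => by rwa [hcyc φ hφ]), hcyc ψ ψ.2]
    rfl
  -- The prescribed value at `c` is an involution, hence a unit that is its own inverse.
  obtain ⟨G, hGc, hG⟩ := exists_majorana_of_faces hrel.edge_sq hrel.edge_swap hface c
    ⟨compress K (cornerMajorana a b c), compress K (cornerMajorana a b c), hmaj.sq, hmaj.sq⟩
  have hGc' : G c = compress K (cornerMajorana a b c) := hGc
  have hfam : IsMajoranaFamily LatticeAdj (fun j k => compress K (edgeOp a b j k))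
      (fun j => compress K (vertexOp a b j)) G :=
    isMajoranaFamily_of_step hrel lattice_induction (hGc' ▸ hmaj) hG
  obtain ⟨T, hTE, hTN, hTG⟩ := hfam.exists_fock_equiv hrel (by
    rw [finrank_codeSpace hF, Fintype.card_prod, Fintype.card_fin, Fintype.card_fin])
  refine ⟨T, fun j k hjk ψ => ?_, fun j ψ => ?_, fun ψ => ?_⟩
  · rw [hTE j k hjk, compress_apply (hE hjk)]
  · rw [hTN, compress_apply (hN j)]
  · rw [hTG, hGc', compress_apply hg]

end Encoding

end CompactEncoding
end

/-! ### The main theorem. -/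

open CompactEncoding
theorem mainTheorem1 (L₁ L₂ : ℕ) (hL₁ : 1 ≤ L₁) (hL₂ : 1 ≤ L₂)
    (hF : Even ((L₁ - 1) * (L₂ - 1))) (a b : ℕ) :
    Fintype.card (Qubit L₁ L₂ a b) = L₁ * L₂ + (L₁ - 1) * (L₂ - 1) / 2 ∧
    (∀ f : Face L₁ L₂, cycleOp a b f ≠ 1 ↔ ¬ IsOddFace a b f) ∧
    Set.ncard {f : Face L₁ L₂ | cycleOp a b f ≠ 1} = (L₁ - 1) * (L₂ - 1) / 2 ∧
    Module.finrank ℂ (codeSpace L₁ L₂ a b) = 2 ^ (L₁ * L₂) ∧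
    (∃ c : Vertex L₁ L₂, IsOddCorner a b c) ∧
    ∀ c : Vertex L₁ L₂, IsOddCorner a b c →
      ∃ μ : (Fock (Vertex L₁ L₂) →L[ℂ] Fock (Vertex L₁ L₂)) ≃⋆ₐ[ℂ]
          (codeSpace L₁ L₂ a b →L[ℂ] codeSpace L₁ L₂ a b),
        (∀ j k : Vertex L₁ L₂, LatticeAdj j k → ∀ ψ : codeSpace L₁ L₂ a b,
          (μ (fermiEdge j k) ψ : QubitSpace (Qubit L₁ L₂ a b)) = edgeOp a b j k ψ) ∧
        (∀ (j : Vertex L₁ L₂) (ψ : codeSpace L₁ L₂ a b),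
          (μ (fermiVertex j) ψ : QubitSpace (Qubit L₁ L₂ a b)) = vertexOp a b j ψ) ∧
        (∀ ψ : codeSpace L₁ L₂ a b,
          (μ (majorana c) ψ : QubitSpace (Qubit L₁ L₂ a b)) = cornerMajorana a b c ψ) ∧
        ∃ J : Fock (Vertex L₁ L₂) →ₗᵢ[ℂ] codeSpace L₁ L₂ a b,
          ∀ A : Fock (Vertex L₁ L₂) →L[ℂ] Fock (Vertex L₁ L₂),
            μ A = J.toContinuousLinearMap ∘L A ∘L
              ContinuousLinearMap.adjoint J.toContinuousLinearMap := by
  refine ⟨card_qubit hF a b, cycleOp_ne_one_iff, ?_, finrank_codeSpace hF a b,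
    exists_oddCorner hL₁ hL₂ hF a b, fun c hc => ?_⟩
  · simp only [cycleOp_ne_one_iff]
    rw [← (card_oddFace hF a b).2, ← Nat.card_eq_fintype_card]
    rfl
  · obtain ⟨T, hE, hV, hM⟩ := exists_encoding hF hc
    -- The isometry `J` is the unitary `T` itself, so its adjoint is its inverse and `J A J†` is
    -- conjugation by `T`.
    refine ⟨T.conjStarAlgEquiv, hE, hV, hM, T.toLinearIsometry, fun A => ?_⟩
    have hadj : ContinuousLinearMap.adjoint T.toLinearIsometry.toContinuousLinearMap =
        (T.symm : codeSpace L₁ L₂ a b →L[ℂ] Fock (Vertex L₁ L₂)) :=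
      T.adjoint_eq_symm
    rw [hadj, LinearIsometryEquiv.conjStarAlgEquiv_apply]
    rfl
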